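/- Let $d\ge 0$ and $k\ge 2$ be integers and let $\mathbf T^d=\mathbb R^d/\mathbb Z^d$ carry its uniform probability measure. Let $F_{in},F_{out}\colon\mathbf T^d\to[0,1]$ be measurable functions with $F_{in}(-x)=F_{in}(x)$ and $F_{out}(-x)=F_{out}(x)$ for all $x$ (for instance, functions that depend only on the distance from $x$ to $0$). Put $\mu_{in}=\int_{\mathbf T^d}F_{in}(x)\,dx$, $\mu_{out}=\int_{\mathbf T^d}F_{out}(x)\,dx$ and $\hat F(z)=\int_{\mathbf T^d}F(x)e^{-2\pi i\langle z,x\rangle}dx$ for $z\in\mathbb Z^d$. Assume that $\mu_{in}>\mu_{out}>0$ and that $$\hat F_{in}(z)+(k-1)\hat F_{out}(z)\ne\mu_{in}-\mu_{out}\quad\text{for all } z\in\mathbb Z^d,$$ $$\hat F_{in}(z)-\hat F_{out}(z)\ne\mu_{in}-\mu_{out}\quad\text{for all } z\in\mathbb Z^d\setminus\{0\}.$$ For $n$ divisible by $k$ and an assignment $\sigma\colon\{1,\dots,n\}\to\{1,\dots,k\}$ with $k$ communities of size $n/k$, the soft geometric block model is the random graph $G$ on $\{1,\dots,n\}$ obtained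 as follows: $X_1,\dots,X_n$ are independent and uniform in $\mathbf T^d$ and, given $X_1,\dots,X_n$, the pairs $i<j$ are edges independently, with probability $F_{in}(X_i-X_j)$ if $\sigma(i)=\sigma(j)$ and $F_{out}(X_i-X_j)$ otherwise. Let $A$ be the adjacency matrix of $G$, let $B_\sigma=(b_{ij})$ be the $n\times n$ matrix with $b_{ij}=\mu_{in}$ if $\sigma(i)=\sigma(j)$ and $b_{ij}=\mu_{out}$ otherwise, and let $\lambda_*=\frac{\mu_{in}-\mu_{out}}{k}\,n$. Then there is $\epsilon>0$, depending only on $d,k,F_{in},F_{out}$, such that for every sequence of such pairs $(n,\sigma)$ with $n\to\infty$ the following holds with probability tending to $1$. For every $U\in\mathbb R^{n\times(k-1)}$ whose columns are orthonormal eigenvectors of $B_\sigma$ for the eigenvalue $\lambda_*$, and every $V\in\mathbb R^{n\times(k-1)}$ whose columns are orthonormal eigenvectors of $A$ for $k-1$ eigenvalues of $A$ (counted with multiplicity) that are closest to $\lambda_*$, $$\min_{Q}\|VQ-U\|_F\le\frac{\sqrt{12k^5\log n}}{\epsilon\sqrt n},$$ where the minimum is over all real orthogonal matrices $Q$ of order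 $k-1$ and $\|\cdot\|_F$ is the Frobenius norm. -/

import Mathlib

open MeasureTheory Filter Topology
open scoped Matrix

attribute [local instance] Matrix.frobeniusNormedAddCommGroup

namespace SGBM

/-- The uniform (Haar) probability measure on the flat torus `ℝᵈ / ℤᵈ`. -/
noncomputable def uniformTorus (d : ℕ) : Measure (UnitAddTorus (Fin d)) :=
  Measure.pi fun _ => AddCircle.haarAddCircle

/-- The law of `n` independent uniform points `X₁, …, Xₙ` of the torus. -/
noncomputable def uniformPoints (d n : ℕ) : Measure (Fin n → UnitAddTorus (Fin d)) :=
  Measure.pi fun _ => uniformTorus d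

/-- The edge density `∫ F` of a connectivity probability function. -/
noncomputable def density {d : ℕ} (F : UnitAddTorus (Fin d) → ℝ) : ℝ :=
  ∫ x, F x ∂(uniformTorus d)

/-- The Fourier coefficient `∫ F(x) exp(-2πi⟨z,x⟩) dx` of a real function on the torus. -/
noncomputable def fourierCoeff {d : ℕ} (F : UnitAddTorus (Fin d) → ℝ) (z : Fin d → ℤ) : ℂ :=
  UnitAddTorus.mFourierCoeff (fun x => (F x : ℂ)) z

/-- The assignment `σ` of `n` vertices to `k` communities has communities of equal size. -/
def IsBalanced {n k : ℕ} (σ : Fin n → Fin k) : Prop :=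
  ∀ q : Fin k, k * (Finset.univ.filter fun i => σ i = q).card = n

/-- The probability of the edge `ij`: `F_in (X_i - X_j)` within a community, and
`F_out (X_i - X_j)` between distinct communities. -/
def edgeProb {d n k : ℕ} (Fi Fo : UnitAddTorus (Fin d) → ℝ) (σ : Fin n → Fin k)
    (X : Fin n → UnitAddTorus (Fin d)) (i j : Fin n) : ℝ :=
  if σ i = σ j then Fi (X i - X j) else Fo (X i - X j)

open Classical in
/-- The probability `P_{σ,X}(G)` of the labelled graph `G` given the positions `X`: the edges are
drawn independently. -/
noncomputable def condProb {d n k : ℕ} (Fi Fo : UnitAddTorus (Fin d) → ℝ) (σ : Fin n → Fin k)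
    (X : Fin n → UnitAddTorus (Fin d)) (G : SimpleGraph (Fin n)) : ℝ :=
  ∏ i : Fin n, ∏ j ∈ Finset.Ioi i,
    if G.Adj i j then edgeProb Fi Fo σ X i j else 1 - edgeProb Fi Fo σ X i j

/-- The probability that the random graph of the soft geometric block model lies in `S`, when the
positions are independent and uniform in the torus. -/
noncomputable def prob {d n k : ℕ} (Fi Fo : UnitAddTorus (Fin d) → ℝ) (σ : Fin n → Fin k)
    (S : Set (SimpleGraph (Fin n))) : ℝ :=
  ∫ X, (∑ G : SimpleGraph (Fin n), S.indicator (condProb Fi Fo σ X) G) ∂(uniformPoints d n)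

open Classical in
/-- The adjacency matrix of `G`. -/
noncomputable def adj {n : ℕ} (G : SimpleGraph (Fin n)) : Matrix (Fin n) (Fin n) ℝ :=
  G.adjMatrix ℝ

/-- The matrix `B_σ`. -/
def blockMatrix {n k : ℕ} (μin μout : ℝ) (σ : Fin n → Fin k) : Matrix (Fin n) (Fin n) ℝ :=
  Matrix.of fun i j => if σ i = σ j then μin else μout

/-- The columns of `W` are orthonormal eigenvectors of `M`, the `j`-th one for the
eigenvalue `ev j`. -/
def IsOrthonormalEigenvectors {n r : ℕ} (M : Matrix (Fin n) (Fin n) ℝ) (ev : Fin r → ℝ)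
    (W : Matrix (Fin n) (Fin r) ℝ) : Prop :=
  Wᵀ * W = 1 ∧ ∀ j, M *ᵥ W.col j = ev j • W.col j

/-- The columns of `V` are orthonormal eigenvectors of the symmetric matrix `M` for `r` eigenvalues
of `M`, counted with multiplicity, that are closest to `c`: no eigenvalue of `M` on the orthogonal
complement of the columns of `V` (these are the eigenvalues that remain after the chosen ones are
removed, with multiplicity) is closer to `c` than a chosen one. -/
def IsClosestEigenvectors {n r : ℕ} (M : Matrix (Fin n) (Fin n) ℝ) (c : ℝ)
    (V : Matrix (Fin n) (Fin r) ℝ) : Prop :=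
  ∃ ev : Fin r → ℝ, IsOrthonormalEigenvectors M ev V ∧
    ∀ (ν : ℝ) (w : Fin n → ℝ), w ≠ 0 → M *ᵥ w = ν • w → (∀ j, V.col j ⬝ᵥ w = 0) →
      ∀ j, |ev j - c| ≤ |ν - c|

/-- The minimum over the real orthogonal matrices `Q` of the Frobenius norm `‖V Q - U‖` is attained
and is at most `b`. -/
def MinProcrustesLE {n r : ℕ} (V U : Matrix (Fin n) (Fin r) ℝ) (b : ℝ) : Prop :=
  ∃ Q ∈ Matrix.orthogonalGroup (Fin r) ℝ,
    (∀ Q' ∈ Matrix.orthogonalGroup (Fin r) ℝ, ‖V * Q - U‖ ≤ ‖V * Q' - U‖) ∧ ‖V * Q - U‖ ≤ b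

end SGBM

namespace SGBM

open Finset
open scoped ComplexConjugate

set_option linter.unusedSectionVars false

/-! Write `c = μ / k` with `μ = density Fi - density Fo`, so that `λ_* = c n`. Eigenvectors of `B_σ`
for `λ_*` are constant on communities, hence approximate eigenvectors of `A`; a spectral gap for `A`
around `λ_*` off a subspace of dimension `k - 1` then forces the eigenvectors of `A` closest to
`λ_*` to span nearly the same space (a Davis–Kahan argument).

All randomness is confined to one number, `discrepancy`. It collects the squared residuals of
finitely many Fourier modes (cut off to a community) as approximate eigenvectors of `A`, and the
squared deviations of codegrees from their means given the positions. Summands attached to distinct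
vertices are uncorrelated, apart from a few exceptions, so its expectation is `O(n²)`
(`mean_discrepancy_le`). Markov's inequality bounds it by `n² log n` with probability tending to 1
(`one_sub_le_prob`), and everything else is deterministic.

The gap (`exists_spectral_gap`) concerns unit vectors `x` with equal sums over all communities, a
space of codimension at most `k - 1`. Suppose that `‖(A - λ_*) x‖ < ε n`. Pairing with the mode `z`
shows that the vector of community Fourier sums of `x` nearly solves the equation with eigenvalue
`μ` for the `k × k` matrix having `F̂_in(z)` on and `F̂_out(z)` off the diagonal. The eigenvalues of
this matrix are `F̂_in + (k-1) F̂_out` and `F̂_in - F̂_out`; by hypothesis neither is `μ`, except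
the second at `z = 0`, where the equal sums exclude its eigenspace. So the sums are small for every
`z` in a finite set `Z`. On the other hand `‖A x‖² = xᵀ A² x`, the entries of `A²` are codegrees,
and by Parseval their conditional means give a quadratic form in the Fourier sums, whose part
outside `Z` is small because `F_in` and `F_out` are square integrable. Hence `‖A x‖` is too small
compared with `λ_*`, a contradiction. Passing to `A²` replaces any concentration of `A` in operator
norm by second moments, and no smoothness of `F_in`, `F_out` is needed.

Finally the gap bounds the part of `U` outside the span of `V`, and the polar factor of `Vᵀ U`
supplies a good orthogonal matrix (`minProcrustesLE_of_norm_sub_lt_one`). -/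

/-! ### Independence of the edges given the positions -/

theorem sum_prod_edges {n : ℕ} (f g : Fin n → Fin n → ℝ) :
    (∑ G : SimpleGraph (Fin n), ∏ i, ∏ j ∈ Ioi i,
      open Classical in if G.Adj i j then f i j else g i j)
      = ∏ i, ∏ j ∈ Ioi i, (f i j + g i j) := by
  classical
  have hs : ∀ h : Fin n → Fin n → ℝ, ∏ i, ∏ j ∈ Ioi i, h i j
      = ∏ x ∈ (univ : Finset (Fin n)).sigma (fun i => Ioi i), h x.1 x.2 := fun h => by
    rw [Finset.prod_sigma]
  rw [hs, Finset.prod_add]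
  -- Expanding the product of sums gives a sum over sets of pairs `i < j`, and these sets are the
  -- edge sets of graphs.
  refine Finset.sum_bij' (fun G _ => {x ∈ (univ : Finset (Fin n)).sigma (fun i => Ioi i) | G.Adj x.1 x.2})
    (fun t _ => SimpleGraph.fromRel fun i j => (⟨i, j⟩ : Σ _ : Fin n, Fin n) ∈ t) ?_ ?_ ?_ ?_ ?_
  · intro G _; simp
  · intro t _; simp
  · intro G _
    ext i j
    simp only [SimpleGraph.fromRel_adj, mem_filter, mem_sigma, mem_univ, mem_Ioi, true_and]
    constructor
    · rintro ⟨-, ⟨-, h⟩ | ⟨-, h⟩⟩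
      exacts [h, h.symm]
    · intro h
      refine ⟨h.ne, ?_⟩
      rcases lt_or_gt_of_ne h.ne with h' | h'
      exacts [Or.inl ⟨h', h⟩, Or.inr ⟨h', h.symm⟩]
  · intro t ht
    ext ⟨i, j⟩
    have key : ∀ a b, (⟨a, b⟩ : Σ _ : Fin n, Fin n) ∈ t → a < b := fun a b hab => by
      simpa using (mem_powerset.1 ht) hab
    simp only [SimpleGraph.fromRel_adj, mem_filter, mem_sigma, mem_univ, mem_Ioi, true_and]
    constructor
    · rintro ⟨h1, -, h | h⟩
      exacts [h, absurd (key _ _ h) h1.asymm]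
    · intro h
      exact ⟨key _ _ h, (key _ _ h).ne, Or.inl h⟩
  · intro G _
    rw [hs, Finset.prod_ite]
    congr 1
    exact Finset.prod_congr (by ext; simp; tauto) fun _ _ => rfl

/-- Disjointness makes the pairs in `I × J` distinct as unordered pairs, so their edges are
independent and the expected product factors. Empty `I` and `J` give total mass one. -/
theorem sum_condProb_mul_prod_adj {d n k : ℕ} (Fi Fo : UnitAddTorus (Fin d) → ℝ) (σ : Fin n → Fin k)
    (hFi_even : ∀ x, Fi (-x) = Fi x) (hFo_even : ∀ x, Fo (-x) = Fo x)
    (X : Fin n → UnitAddTorus (Fin d)) (I J : Finset (Fin n)) (hIJ : Disjoint I J) :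
    ∑ G : SimpleGraph (Fin n), condProb Fi Fo σ X G * ∏ i ∈ I, ∏ j ∈ J, adj G i j
      = ∏ i ∈ I, ∏ j ∈ J, edgeProb Fi Fo σ X i j := by
  classical
  set p := edgeProb Fi Fo σ X with hp
  have hsymm : ∀ i j, p i j = p j i := fun i j => by
    simp only [hp, edgeProb, eq_comm (a := σ i)]
    rw [← neg_sub (X j), hFi_even, hFo_even]
  have hoff : ∀ i ∈ I, ∀ j ∈ J, i ≠ j := fun i hi j hj h => Finset.disjoint_left.1 hIJ hi (h ▸ hj)
  have reidx : ∀ h : Fin n → Fin n → ℝ, (∀ i j, h i j = h j i) →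
      ∏ i ∈ I, ∏ j ∈ J, h i j
        = ∏ i, ∏ j ∈ Ioi i, if (i ∈ I ∧ j ∈ J) ∨ (j ∈ I ∧ i ∈ J) then h i j else 1 := by
    intro h hh
    have e1 := Finset.prod_prod_Ioi_mul_eq_prod_prod_off_diag
      (fun i j => if j ∈ I ∧ i ∈ J then h i j else 1)
    have e2 : ∏ i ∈ I, ∏ j ∈ J, h i j = ∏ i, ∏ j ∈ {i}ᶜ, if i ∈ I ∧ j ∈ J then h j i else 1 := by
      rw [← Finset.prod_subset (Finset.subset_univ I)]
      · refine Finset.prod_congr rfl fun i hi => ?_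
        rw [← Finset.prod_subset (s₁ := J) (s₂ := {i}ᶜ) (f := fun j => if i ∈ I ∧ j ∈ J then h j i else 1)
          (fun j hj => by simpa using (hoff i hi j hj).symm) (fun j _ hj => by simp [hj])]
        exact Finset.prod_congr rfl fun j hj => by simp [hi, hj, hh i j]
      · intro i _ hi; simp [hi]
    rw [e2, ← e1]
    refine Finset.prod_congr rfl fun i _ => Finset.prod_congr rfl fun j _ => ?_
    have hi : i ∈ I → i ∉ J := fun h => Finset.disjoint_left.1 hIJ h
    have hj : j ∈ I → j ∉ J := fun h => Finset.disjoint_left.1 hIJ h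
    rw [hh j i]
    by_cases h1 : i ∈ I <;> by_cases h2 : j ∈ I <;> simp_all
  have hadj : ∀ G : SimpleGraph (Fin n), ∀ i j, adj G i j = if G.Adj i j then 1 else 0 := fun G i j => by
    simp [adj, SimpleGraph.adjMatrix_apply]
  rw [reidx p hsymm]
  -- The factor `∏ adj` requires these edges to be present, which amounts to replacing the weight `1
  -- - p` of their absence by `0`.
  have := sum_prod_edges p (fun i j => if (i ∈ I ∧ j ∈ J) ∨ (j ∈ I ∧ i ∈ J) then 0 else 1 - p i j)
  convert this using 1
  · refine Finset.sum_congr rfl fun G _ => ?_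
    rw [reidx (adj G) (fun i j => by rw [hadj, hadj, G.adj_comm i j]), condProb]
    simp only [← Finset.prod_mul_distrib]
    refine Finset.prod_congr rfl fun i _ => Finset.prod_congr rfl fun j _ => ?_
    rw [hadj]
    split_ifs <;> simp [hp]
  · refine Finset.prod_congr rfl fun i _ => Finset.prod_congr rfl fun j _ => ?_
    split_ifs <;> simp

/-! ### Characters and Fourier coefficients on the torus -/

instance (d : ℕ) : IsProbabilityMeasure (uniformTorus d) := by
  unfold uniformTorus; infer_instance

instance (d : ℕ) : (uniformTorus d).IsAddHaarMeasure := by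
  unfold uniformTorus; infer_instance

instance (d n : ℕ) : IsProbabilityMeasure (uniformPoints d n) := by
  unfold uniformPoints; infer_instance

/-- Fubini, integrating over the coordinate `l` first. -/
theorem integral_pi_eq_zero_of_update {n : ℕ} {α : Type*} [MeasurableSpace α] (ν : Measure α)
    [IsProbabilityMeasure ν] (l : Fin n) (f : (Fin n → α) → ℂ)
    (hf : Integrable f (Measure.pi fun _ => ν))
    (h : ∀ X, ∫ u, f (Function.update X l u) ∂ν = 0) :
    ∫ X, f X ∂(Measure.pi fun _ => ν) = 0 := by
  obtain ⟨u₀⟩ : Nonempty α := nonempty_of_isProbabilityMeasure ν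
  cases n with
  | zero => exact l.elim0
  | succ n =>
    have e := (measurePreserving_piFinSuccAbove (fun _ : Fin (n + 1) => ν) l).symm
    rw [← e.integral_comp', integral_prod_symm (fun p => f ((MeasurableEquiv.piFinSuccAbove (fun _ => α) l).symm p))
      (e.integrable_comp_of_integrable hf)]
    refine integral_eq_zero_of_ae (Eventually.of_forall fun Y => ?_)
    have := h (l.insertNth u₀ Y)
    simp only [Fin.update_insertNth] at this
    exact this

theorem mFourier_add_apply {d : ℕ} (z : Fin d → ℤ) (x y : UnitAddTorus (Fin d)) :
    UnitAddTorus.mFourier z (x + y) = UnitAddTorus.mFourier z x * UnitAddTorus.mFourier z y := by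
  simp only [UnitAddTorus.mFourier, ContinuousMap.coe_mk, ← Finset.prod_mul_distrib]
  refine Finset.prod_congr rfl fun i _ => ?_
  simp [fourier_apply, smul_add, AddCircle.toCircle_add]

theorem norm_mFourier_apply {d : ℕ} (z : Fin d → ℤ) (x : UnitAddTorus (Fin d)) :
    ‖UnitAddTorus.mFourier z x‖ = 1 := by
  simp only [UnitAddTorus.mFourier, ContinuousMap.coe_mk, norm_prod, fourier_apply]
  exact Finset.prod_eq_one fun i _ => Circle.norm_coe _

theorem fourierCoeff_eq {d : ℕ} (F : UnitAddTorus (Fin d) → ℝ) (z : Fin d → ℤ) :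
    fourierCoeff F z = ∫ x, UnitAddTorus.mFourier (-z) x * F x ∂(uniformTorus d) := rfl

theorem fourierCoeff_zero {d : ℕ} (F : UnitAddTorus (Fin d) → ℝ) :
    fourierCoeff F 0 = density F := by
  rw [fourierCoeff_eq, density, ← integral_complex_ofReal]
  simp [UnitAddTorus.mFourier_zero]

theorem norm_fourierCoeff_le {d : ℕ} (F : UnitAddTorus (Fin d) → ℝ)
    (hF : ∀ x, F x ∈ Set.Icc (0 : ℝ) 1) (z : Fin d → ℤ) : ‖fourierCoeff F z‖ ≤ 1 := by
  rw [fourierCoeff_eq]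
  refine (norm_integral_le_of_norm_le_const (C := 1) (Eventually.of_forall fun x => ?_)).trans
    (by simp)
  rw [norm_mul, norm_mFourier_apply, one_mul, Complex.norm_real, Real.norm_eq_abs, abs_le]
  exact ⟨by linarith [(hF x).1], (hF x).2⟩

/-- Characters are eigenfunctions of convolution; evenness turns `F (x - y)` into `F (y - x)` before
the translation. -/
theorem integral_mFourier_mul_sub {d : ℕ} (F : UnitAddTorus (Fin d) → ℝ)
    (hF : ∀ x, F (-x) = F x) (z : Fin d → ℤ) (x : UnitAddTorus (Fin d)) :
    ∫ y, UnitAddTorus.mFourier (-z) y * (F (x - y) : ℂ) ∂(uniformTorus d)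
      = UnitAddTorus.mFourier (-z) x * fourierCoeff F z := by
  rw [fourierCoeff_eq, ← integral_const_mul, ← integral_add_right_eq_self _ x]
  refine integral_congr_ae (Eventually.of_forall fun u => ?_)
  simp only [mFourier_add_apply]
  rw [show x - (u + x) = -u by abel, hF]
  ring

theorem hasSum_sq_fourierCoeff {d : ℕ} (f : UnitAddTorus (Fin d) → ℝ) (hf : Measurable f)
    (C : ℝ) (hC : ∀ x, |f x| ≤ C) :
    HasSum (fun z => ‖fourierCoeff f z‖ ^ 2) (∫ x, f x ^ 2 ∂(uniformTorus d)) := by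
  have hm : MemLp (fun x => (f x : ℂ)) 2 (uniformTorus d) :=
    MemLp.of_bound (by fun_prop) C (Eventually.of_forall fun x => by simpa using hC x)
  have h : HasSum (fun z => ‖UnitAddTorus.mFourierCoeff (hm.toLp _) z‖ ^ 2)
      (∫ x, ‖(hm.toLp _) x‖ ^ 2 ∂(uniformTorus d)) :=
    UnitAddTorus.hasSum_sq_mFourierCoeff (hm.toLp _)
  have h1 : ∀ z, UnitAddTorus.mFourierCoeff (hm.toLp _) z = fourierCoeff f z := fun z => by
    refine integral_congr_ae ?_
    filter_upwards [hm.coeFn_toLp] with x hx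
    rw [hx]
  simp only [h1] at h
  convert h using 1
  refine integral_congr_ae ?_
  filter_upwards [hm.coeFn_toLp] with x hx
  rw [hx]; simp

/-! ### Expectations over positions and graphs -/

/-- A connectivity probability function: measurable, even, with values in `[0, 1]`. -/
structure IsConnectivity {d : ℕ} (F : UnitAddTorus (Fin d) → ℝ) : Prop where
  measurable : Measurable F
  mem : ∀ x, F x ∈ Set.Icc (0 : ℝ) 1
  even : ∀ x, F (-x) = F x

/-- The connectivity probability function between the communities `p` and `q`. -/
def block {d k : ℕ} (Fi Fo : UnitAddTorus (Fin d) → ℝ) (p q : Fin k) : UnitAddTorus (Fin d) → ℝ :=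
  if p = q then Fi else Fo

section
variable {d n k : ℕ} {Fi Fo : UnitAddTorus (Fin d) → ℝ}

theorem IsConnectivity.block (hi : IsConnectivity Fi) (ho : IsConnectivity Fo) (p q : Fin k) :
    IsConnectivity (block Fi Fo p q) := by
  unfold SGBM.block; split_ifs <;> assumption

theorem edgeProb_eq_block (σ : Fin n → Fin k) (X : Fin n → UnitAddTorus (Fin d)) (i j : Fin n) :
    edgeProb Fi Fo σ X i j = block Fi Fo (σ i) (σ j) (X i - X j) := by
  unfold edgeProb block; split_ifs <;> rfl

theorem edgeProb_mem (hi : IsConnectivity Fi) (ho : IsConnectivity Fo) (σ : Fin n → Fin k)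
    (X : Fin n → UnitAddTorus (Fin d)) (i j : Fin n) :
    edgeProb Fi Fo σ X i j ∈ Set.Icc (0 : ℝ) 1 := by
  rw [edgeProb_eq_block]; exact (hi.block ho _ _).mem _

theorem measurable_edgeProb (hi : IsConnectivity Fi) (ho : IsConnectivity Fo) (σ : Fin n → Fin k)
    (i j : Fin n) : Measurable fun X => edgeProb Fi Fo σ X i j := by
  simp only [edgeProb_eq_block]
  exact (hi.block ho _ _).measurable.comp (by fun_prop)

theorem condProb_nonneg (hi : IsConnectivity Fi) (ho : IsConnectivity Fo) (σ : Fin n → Fin k)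
    (X : Fin n → UnitAddTorus (Fin d)) (G : SimpleGraph (Fin n)) : 0 ≤ condProb Fi Fo σ X G := by
  refine Finset.prod_nonneg fun i _ => Finset.prod_nonneg fun j _ => ?_
  have := edgeProb_mem hi ho σ X i j
  split_ifs
  exacts [this.1, sub_nonneg.2 this.2]

theorem measurable_condProb (hi : IsConnectivity Fi) (ho : IsConnectivity Fo) (σ : Fin n → Fin k)
    (G : SimpleGraph (Fin n)) : Measurable fun X => condProb Fi Fo σ X G := by
  refine Finset.measurable_prod _ fun i _ => Finset.measurable_prod _ fun j _ => ?_
  have := measurable_edgeProb hi ho σ i j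
  split_ifs
  exacts [this, this.const_sub 1]

theorem sum_condProb (hi : IsConnectivity Fi) (ho : IsConnectivity Fo) (σ : Fin n → Fin k)
    (X : Fin n → UnitAddTorus (Fin d)) : ∑ G, condProb Fi Fo σ X G = 1 := by
  simpa using sum_condProb_mul_prod_adj Fi Fo σ hi.even ho.even X ∅ ∅ (by simp)

theorem adj_eq (G : SimpleGraph (Fin n)) (i j : Fin n) [Decidable (G.Adj i j)] :
    adj G i j = if G.Adj i j then 1 else 0 := by
  simp [adj, SimpleGraph.adjMatrix_apply]

theorem adj_mem (G : SimpleGraph (Fin n)) (i j : Fin n) : adj G i j ∈ Set.Icc (0 : ℝ) 1 := by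
  classical
  rw [adj_eq]; split_ifs <;> simp

theorem adj_symm (G : SimpleGraph (Fin n)) (i j : Fin n) : adj G i j = adj G j i := by
  classical
  rw [adj_eq, adj_eq, G.adj_comm]

variable {E : Type*} [NormedAddCommGroup E] [NormedSpace ℝ E]

/-- The expectation of a function of the positions and the graph. -/
noncomputable def mean (Fi Fo : UnitAddTorus (Fin d) → ℝ) (σ : Fin n → Fin k)
    (Φ : (Fin n → UnitAddTorus (Fin d)) → SimpleGraph (Fin n) → E) : E :=
  ∫ X, ∑ G, condProb Fi Fo σ X G • Φ X G ∂(uniformPoints d n)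

/-- Bounded observables of the positions and the graph, measurable in the positions. -/
def IsBddObservable (Φ : (Fin n → UnitAddTorus (Fin d)) → SimpleGraph (Fin n) → E) : Prop :=
  (∀ G, StronglyMeasurable fun X => Φ X G) ∧ ∃ C : ℝ, ∀ X G, ‖Φ X G‖ ≤ C

theorem norm_sum_condProb_smul_le (hi : IsConnectivity Fi) (ho : IsConnectivity Fo)
    (σ : Fin n → Fin k) (X : Fin n → UnitAddTorus (Fin d)) (f : SimpleGraph (Fin n) → E) (C : ℝ)
    (hf : ∀ G, ‖f G‖ ≤ C) : ‖∑ G, condProb Fi Fo σ X G • f G‖ ≤ C := by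
  calc _ ≤ ∑ G, condProb Fi Fo σ X G * C := by
        refine norm_sum_le_of_le _ fun G _ => ?_
        rw [norm_smul, Real.norm_of_nonneg (condProb_nonneg hi ho σ X G)]
        exact mul_le_mul_of_nonneg_left (hf G) (condProb_nonneg hi ho σ X G)
    _ = C := by rw [← Finset.sum_mul, sum_condProb hi ho, one_mul]

theorem IsBddObservable.integrable (hi : IsConnectivity Fi) (ho : IsConnectivity Fo)
    (σ : Fin n → Fin k) {Φ : (Fin n → UnitAddTorus (Fin d)) → SimpleGraph (Fin n) → E}
    (hΦ : IsBddObservable Φ) :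
    Integrable (fun X => ∑ G, condProb Fi Fo σ X G • Φ X G) (uniformPoints d n) := by
  obtain ⟨hm, C, hC⟩ := hΦ
  refine Integrable.of_bound (StronglyMeasurable.aestronglyMeasurable ?_) C
    (Eventually.of_forall fun X => norm_sum_condProb_smul_le hi ho σ X _ C (hC X))
  exact Finset.stronglyMeasurable_fun_sum _ fun G _ =>
    (measurable_condProb hi ho σ G).stronglyMeasurable.smul (hm G)

theorem norm_mean_le (hi : IsConnectivity Fi) (ho : IsConnectivity Fo)
    (σ : Fin n → Fin k) {Φ : (Fin n → UnitAddTorus (Fin d)) → SimpleGraph (Fin n) → E} (C : ℝ)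
    (hC : ∀ X G, ‖Φ X G‖ ≤ C) : ‖mean Fi Fo σ Φ‖ ≤ C :=
  (norm_integral_le_of_norm_le_const (Eventually.of_forall fun X =>
    norm_sum_condProb_smul_le hi ho σ X _ C (hC X))).trans (by simp)

theorem mean_sum (hi : IsConnectivity Fi) (ho : IsConnectivity Fo) (σ : Fin n → Fin k) {ι : Type*}
    (s : Finset ι) {Φ : ι → (Fin n → UnitAddTorus (Fin d)) → SimpleGraph (Fin n) → E}
    (hΦ : ∀ a ∈ s, IsBddObservable (Φ a)) :
    mean Fi Fo σ (fun X G => ∑ a ∈ s, Φ a X G) = ∑ a ∈ s, mean Fi Fo σ (Φ a) := by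
  simp only [mean]
  rw [← integral_finsetSum _ fun a ha => (hΦ a ha).integrable hi ho σ]
  simp only [Finset.smul_sum]
  exact integral_congr_ae (Eventually.of_forall fun X => Finset.sum_comm)

theorem mean_mono (hi : IsConnectivity Fi) (ho : IsConnectivity Fo) (σ : Fin n → Fin k)
    {Φ Ψ : (Fin n → UnitAddTorus (Fin d)) → SimpleGraph (Fin n) → ℝ}
    (hΦ : IsBddObservable Φ) (hΨ : IsBddObservable Ψ) (h : ∀ X G, Φ X G ≤ Ψ X G) :
    mean Fi Fo σ Φ ≤ mean Fi Fo σ Ψ :=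
  integral_mono (hΦ.integrable hi ho σ) (hΨ.integrable hi ho σ) fun X =>
    Finset.sum_le_sum fun G _ => mul_le_mul_of_nonneg_left (h X G) (condProb_nonneg hi ho σ X G)

theorem IsBddObservable.sum {ι : Type*} (s : Finset ι)
    {Φ : ι → (Fin n → UnitAddTorus (Fin d)) → SimpleGraph (Fin n) → E}
    (hΦ : ∀ a ∈ s, IsBddObservable (Φ a)) : IsBddObservable fun X G => ∑ a ∈ s, Φ a X G := by
  have hm := fun a ha => (hΦ a ha).1
  have hb := fun a ha => (hΦ a ha).2
  choose! C hC using hb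
  exact ⟨fun G => Finset.stronglyMeasurable_fun_sum _ fun a ha => hm a ha G,
    ∑ a ∈ s, C a, fun X G => norm_sum_le_of_le _ fun a ha => hC a ha X G⟩

theorem ofReal_mean (σ : Fin n → Fin k)
    (Φ : (Fin n → UnitAddTorus (Fin d)) → SimpleGraph (Fin n) → ℝ) :
    ((mean Fi Fo σ Φ : ℝ) : ℂ) = mean Fi Fo σ fun X G => (Φ X G : ℂ) := by
  simp only [mean]
  rw [← integral_complex_ofReal]
  simp

/-! ### Second moments of vertex fluctuations -/

/-- The difference between `w (X_l) ∏ a_{il}`, where `i` runs over `I`, and its expectation given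
the positions of the vertices in `I`. -/
noncomputable def fluctuation (Fi Fo : UnitAddTorus (Fin d) → ℝ) (σ : Fin n → Fin k)
    (w : Fin n → UnitAddTorus (Fin d) → ℂ) (I : Finset (Fin n)) (l : Fin n)
    (X : Fin n → UnitAddTorus (Fin d)) (G : SimpleGraph (Fin n)) : ℂ :=
  w l (X l) * ∏ i ∈ I, (adj G i l : ℂ)
    - ∫ u, w l u * ∏ i ∈ I, (block Fi Fo (σ i) (σ l) (X i - u) : ℂ) ∂(uniformTorus d)

variable {w : Fin n → UnitAddTorus (Fin d) → ℂ}

theorem norm_mul_prod_le_one {z : ℂ} (hz : ‖z‖ ≤ 1) (I : Finset (Fin n)) (f : Fin n → ℝ)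
    (hf : ∀ i, f i ∈ Set.Icc (0 : ℝ) 1) : ‖z * ∏ i ∈ I, (f i : ℂ)‖ ≤ 1 := by
  rw [norm_mul, norm_prod]
  refine mul_le_one₀ hz (by positivity) (Finset.prod_le_one (fun _ _ => norm_nonneg _) fun i _ => ?_)
  rw [Complex.norm_real, Real.norm_of_nonneg (hf i).1]
  exact (hf i).2

theorem norm_integral_block_le (hi : IsConnectivity Fi) (ho : IsConnectivity Fo) (σ : Fin n → Fin k)
    (hw : ∀ l u, ‖w l u‖ ≤ 1) (I : Finset (Fin n)) (l : Fin n) (X : Fin n → UnitAddTorus (Fin d)) :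
    ‖∫ u, w l u * ∏ i ∈ I, (block Fi Fo (σ i) (σ l) (X i - u) : ℂ) ∂(uniformTorus d)‖ ≤ 1 :=
  (norm_integral_le_of_norm_le_const (Eventually.of_forall fun u =>
    norm_mul_prod_le_one (hw l u) I _ fun _ => (hi.block ho _ _).mem _)).trans (by simp)

theorem norm_fluctuation_le (hi : IsConnectivity Fi) (ho : IsConnectivity Fo) (σ : Fin n → Fin k)
    (hw : ∀ l u, ‖w l u‖ ≤ 1) (I : Finset (Fin n)) (l : Fin n)
    (X : Fin n → UnitAddTorus (Fin d)) (G : SimpleGraph (Fin n)) :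
    ‖fluctuation Fi Fo σ w I l X G‖ ≤ 2 := by
  refine (norm_sub_le _ _).trans ?_
  have h1 := norm_mul_prod_le_one (hw l (X l)) I (fun i => adj G i l) fun _ => adj_mem _ _ _
  have h2 := norm_integral_block_le hi ho σ hw I l X
  linarith

theorem stronglyMeasurable_integral_block (hi : IsConnectivity Fi) (ho : IsConnectivity Fo)
    (σ : Fin n → Fin k) (hwm : ∀ l, Measurable (w l)) (I : Finset (Fin n)) (l : Fin n) :
    StronglyMeasurable fun X : Fin n → UnitAddTorus (Fin d) =>
      ∫ u, w l u * ∏ i ∈ I, (block Fi Fo (σ i) (σ l) (X i - u) : ℂ) ∂(uniformTorus d) := by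
  refine StronglyMeasurable.integral_prod_right' (f := fun p : (Fin n → UnitAddTorus (Fin d)) × _ =>
    w l p.2 * ∏ i ∈ I, (block Fi Fo (σ i) (σ l) (p.1 i - p.2) : ℂ)) ?_
  refine Measurable.stronglyMeasurable (((hwm l).comp measurable_snd).mul
    (Finset.measurable_fun_prod _ fun i _ => ?_))
  exact Complex.measurable_ofReal.comp ((hi.block ho _ _).measurable.comp (by fun_prop))

theorem stronglyMeasurable_fluctuation (hi : IsConnectivity Fi) (ho : IsConnectivity Fo)
    (σ : Fin n → Fin k) (hwm : ∀ l, Measurable (w l)) (I : Finset (Fin n)) (l : Fin n)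
    (G : SimpleGraph (Fin n)) : StronglyMeasurable fun X => fluctuation Fi Fo σ w I l X G :=
  (((hwm l).comp (measurable_pi_apply l)).mul_const _).stronglyMeasurable.sub
    (stronglyMeasurable_integral_block hi ho σ hwm I l)

theorem isBddObservable_fluctuation_mul_conj (hi : IsConnectivity Fi) (ho : IsConnectivity Fo)
    (σ : Fin n → Fin k) (hwm : ∀ l, Measurable (w l)) (hw : ∀ l u, ‖w l u‖ ≤ 1)
    (I : Finset (Fin n)) (l m : Fin n) : IsBddObservable fun X G =>
      fluctuation Fi Fo σ w I l X G * conj (fluctuation Fi Fo σ w I m X G) := by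
  refine ⟨fun G => (stronglyMeasurable_fluctuation hi ho σ hwm I l G).mul
    (Complex.continuous_conj.comp_stronglyMeasurable
      (stronglyMeasurable_fluctuation hi ho σ hwm I m G)), 4, fun X G => ?_⟩
  rw [norm_mul, RCLike.norm_conj]
  nlinarith [norm_fluctuation_le hi ho σ hw I l X G, norm_fluctuation_le hi ho σ hw I m X G,
    norm_nonneg (fluctuation Fi Fo σ w I l X G), norm_nonneg (fluctuation Fi Fo σ w I m X G)]

/-- Given the positions, the edges from `I` to `l` and to `m` are independent, so the conditional
mean is a product `y l * conj (y m)`. Only the first factor involves `X l`, and it averages to zero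
over `X l`, since `h l` is exactly that average. -/
theorem mean_fluctuation_mul_conj (hi : IsConnectivity Fi) (ho : IsConnectivity Fo)
    (σ : Fin n → Fin k) (hwm : ∀ l, Measurable (w l)) (hw : ∀ l u, ‖w l u‖ ≤ 1)
    (I : Finset (Fin n)) {l m : Fin n} (hlm : l ≠ m) (hl : l ∉ I) (hm : m ∉ I) :
    mean Fi Fo σ (fun X G => fluctuation Fi Fo σ w I l X G * conj (fluctuation Fi Fo σ w I m X G))
      = 0 := by
  set h : Fin n → (Fin n → UnitAddTorus (Fin d)) → ℂ := fun l X =>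
    ∫ u, w l u * ∏ i ∈ I, (block Fi Fo (σ i) (σ l) (X i - u) : ℂ) ∂(uniformTorus d) with hh
  set y : Fin n → (Fin n → UnitAddTorus (Fin d)) → ℂ := fun l X =>
    w l (X l) * ∏ i ∈ I, (block Fi Fo (σ i) (σ l) (X i - X l) : ℂ) - h l X with hy
  have hcond : ∀ X, ∑ G, condProb Fi Fo σ X G •
      (fluctuation Fi Fo σ w I l X G * conj (fluctuation Fi Fo σ w I m X G))
      = y l X * conj (y m X) := by
    intro X
    have s0 := sum_condProb hi ho σ X
    have s1 : ∀ l ∉ I, ∑ G, (condProb Fi Fo σ X G : ℂ) * ∏ i ∈ I, (adj G i l : ℂ)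
        = ∏ i ∈ I, (block Fi Fo (σ i) (σ l) (X i - X l) : ℂ) := by
      intro l hl
      have := sum_condProb_mul_prod_adj Fi Fo σ hi.even ho.even X I {l} (by simpa using hl)
      simp only [Finset.prod_singleton, edgeProb_eq_block] at this
      exact_mod_cast congrArg (fun r : ℝ => (r : ℂ)) this
    have s2 : ∑ G, (condProb Fi Fo σ X G : ℂ) *
          ((∏ i ∈ I, (adj G i l : ℂ)) * ∏ i ∈ I, (adj G i m : ℂ))
        = (∏ i ∈ I, (block Fi Fo (σ i) (σ l) (X i - X l) : ℂ)) *
          ∏ i ∈ I, (block Fi Fo (σ i) (σ m) (X i - X m) : ℂ) := by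
      have := sum_condProb_mul_prod_adj Fi Fo σ hi.even ho.even X I {l, m}
        (by simp [hl, hm])
      simp only [Finset.prod_pair hlm, Finset.prod_mul_distrib, edgeProb_eq_block] at this
      exact_mod_cast congrArg (fun r : ℝ => (r : ℂ)) this
    have s0' : ∑ G, (condProb Fi Fo σ X G : ℂ) = 1 := by exact_mod_cast s0
    have e : ∀ G, condProb Fi Fo σ X G •
        (fluctuation Fi Fo σ w I l X G * conj (fluctuation Fi Fo σ w I m X G))
        = w l (X l) * conj (w m (X m)) * ((condProb Fi Fo σ X G : ℂ) *
            ((∏ i ∈ I, (adj G i l : ℂ)) * ∏ i ∈ I, (adj G i m : ℂ)))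
          - w l (X l) * conj (h m X) * ((condProb Fi Fo σ X G : ℂ) * ∏ i ∈ I, (adj G i l : ℂ))
          - h l X * conj (w m (X m)) * ((condProb Fi Fo σ X G : ℂ) * ∏ i ∈ I, (adj G i m : ℂ))
          + h l X * conj (h m X) * (condProb Fi Fo σ X G : ℂ) := by
      intro G
      simp only [fluctuation, map_sub, map_mul, map_prod, Complex.conj_ofReal, Complex.real_smul, hh]
      ring
    simp only [e, Finset.sum_add_distrib, Finset.sum_sub_distrib, ← Finset.mul_sum]
    rw [s1 l hl, s1 m hm, s2, s0']
    simp only [hy, map_sub, map_mul, map_prod, Complex.conj_ofReal]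
    ring
  have hobs := isBddObservable_fluctuation_mul_conj hi ho σ hwm hw I l m
  have hint := hobs.integrable hi ho σ
  rw [mean]
  simp only [hcond] at hint ⊢
  refine integral_pi_eq_zero_of_update (uniformTorus d) l _ hint fun X => ?_
  have hne : ∀ i ∈ I, i ≠ l := fun i hi h => hl (h ▸ hi)
  have hupd : ∀ u, ∀ a, h a (Function.update X l u) = h a X := fun u a => by
    simp only [hh]
    refine integral_congr_ae (Eventually.of_forall fun v => ?_)
    simp only
    congr 1
    exact Finset.prod_congr rfl fun i hi => by rw [Function.update_of_ne (hne i hi)]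
  have hm' : ∀ u, y m (Function.update X l u) = y m X := fun u => by
    simp only [hy, hupd]
    rw [Function.update_of_ne hlm.symm]
    congr 2
    exact Finset.prod_congr rfl fun i hi => by rw [Function.update_of_ne (hne i hi)]
  have hl' : ∀ u, y l (Function.update X l u)
      = w l u * ∏ i ∈ I, (block Fi Fo (σ i) (σ l) (X i - u) : ℂ) - h l X := fun u => by
    simp only [hy, hupd, Function.update_self]
    congr 2
    exact Finset.prod_congr rfl fun i hi => by rw [Function.update_of_ne (hne i hi)]
  simp only [hm', hl']
  rw [integral_mul_const, integral_sub _ (integrable_const _)]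
  · simp [hh]
  · refine Integrable.of_bound (C := 1) (Measurable.aestronglyMeasurable ?_)
      (Eventually.of_forall fun u => norm_mul_prod_le_one (hw l u) I _ fun _ => (hi.block ho _ _).mem _)
    refine (hwm l).mul (Finset.measurable_fun_prod _ fun i _ => ?_)
    exact Complex.measurable_ofReal.comp ((hi.block ho _ _).measurable.comp (by fun_prop))

theorem isBddObservable_sq_norm_sum_fluctuation (hi : IsConnectivity Fi) (ho : IsConnectivity Fo)
    (σ : Fin n → Fin k) (hwm : ∀ l, Measurable (w l)) (hw : ∀ l u, ‖w l u‖ ≤ 1)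
    (I : Finset (Fin n)) :
    IsBddObservable fun X G => ‖∑ l, fluctuation Fi Fo σ w I l X G‖ ^ 2 := by
  refine ⟨fun G => (Finset.stronglyMeasurable_fun_sum _ fun l _ =>
    stronglyMeasurable_fluctuation hi ho σ hwm I l G).norm.pow 2, (∑ _l : Fin n, 2) ^ 2,
    fun X G => ?_⟩
  rw [norm_pow, norm_norm]
  gcongr
  exact norm_sum_le_of_le _ fun l _ => norm_fluctuation_le hi ho σ hw I l X G

/-- After expanding the square, only pairs with `l = m`, `l ∈ I` or `m ∈ I` contribute. There are at
most `n + 2 * #I * n` of them, each contributing at most `2 * 2`. -/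
theorem mean_sq_norm_sum_fluctuation_le (hi : IsConnectivity Fi) (ho : IsConnectivity Fo)
    (σ : Fin n → Fin k) (hwm : ∀ l, Measurable (w l)) (hw : ∀ l u, ‖w l u‖ ≤ 1)
    (I : Finset (Fin n)) :
    mean Fi Fo σ (fun X G => ‖∑ l, fluctuation Fi Fo σ w I l X G‖ ^ 2)
      ≤ 4 * (n + 2 * #I * n) := by
  set b : Fin n → Fin n → ℝ := fun l m =>
    4 * ((if l = m then 1 else 0) + (if l ∈ I then 1 else 0) + (if m ∈ I then 1 else 0)) with hb
  have hbound : ∀ l m, ‖mean Fi Fo σ (fun X G =>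
      fluctuation Fi Fo σ w I l X G * conj (fluctuation Fi Fo σ w I m X G))‖ ≤ b l m := by
    intro l m
    by_cases h : l ≠ m ∧ l ∉ I ∧ m ∉ I
    · rw [mean_fluctuation_mul_conj hi ho σ hwm hw I h.1 h.2.1 h.2.2]
      simp [hb, h]
    · refine (norm_mean_le hi ho σ 4 fun X G => ?_).trans ?_
      · rw [norm_mul, RCLike.norm_conj]
        nlinarith [norm_fluctuation_le hi ho σ hw I l X G, norm_fluctuation_le hi ho σ hw I m X G,
          norm_nonneg (fluctuation Fi Fo σ w I l X G), norm_nonneg (fluctuation Fi Fo σ w I m X G)]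
      · simp only [hb]
        by_cases h1 : l = m <;> by_cases h2 : l ∈ I <;> by_cases h3 : m ∈ I <;> simp_all
  have hexp : ((mean Fi Fo σ (fun X G => ‖∑ l, fluctuation Fi Fo σ w I l X G‖ ^ 2) : ℝ) : ℂ)
      = ∑ l, ∑ m, mean Fi Fo σ (fun X G =>
        fluctuation Fi Fo σ w I l X G * conj (fluctuation Fi Fo σ w I m X G)) := by
    rw [ofReal_mean]
    have hobs := isBddObservable_fluctuation_mul_conj hi ho σ hwm hw I
    simp only [← mean_sum hi ho σ univ (fun m _ => hobs _ m)]
    rw [← mean_sum hi ho σ univ (fun l _ => IsBddObservable.sum univ fun m _ => hobs l m)]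
    congr 1
    ext X G
    rw [Complex.ofReal_pow, ← Complex.mul_conj', map_sum, Finset.sum_mul_sum]
  calc mean Fi Fo σ (fun X G => ‖∑ l, fluctuation Fi Fo σ w I l X G‖ ^ 2)
      ≤ ‖((mean Fi Fo σ (fun X G => ‖∑ l, fluctuation Fi Fo σ w I l X G‖ ^ 2) : ℝ) : ℂ)‖ := by
        rw [Complex.norm_real]; exact le_abs_self _
    _ ≤ ∑ l, ∑ m, b l m := by
        rw [hexp]
        exact norm_sum_le_of_le _ fun l _ => norm_sum_le_of_le _ fun m _ => hbound l m
    _ = 4 * (n + 2 * #I * n) := by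
        simp only [hb, ← Finset.mul_sum, Finset.sum_add_distrib, Finset.sum_ite_eq,
          Finset.mem_univ, if_true, Finset.sum_const, Finset.card_univ, Fintype.card_fin,
          Finset.sum_ite_mem, Finset.univ_inter, nsmul_eq_mul]
        ring
end

/-! ### The discrepancy and Markov's inequality -/

section
variable {d n k : ℕ} {Fi Fo : UnitAddTorus (Fin d) → ℝ}

/-- The residual at the vertex `i` of the Fourier mode `z` on the community `q`, as an approximate
eigenvector of the adjacency matrix. -/
noncomputable def modeResidual (Fi Fo : UnitAddTorus (Fin d) → ℝ) (σ : Fin n → Fin k)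
    (z : Fin d → ℤ) (q : Fin k) (i : Fin n)
    (X : Fin n → UnitAddTorus (Fin d)) (G : SimpleGraph (Fin n)) : ℂ :=
  ∑ l, fluctuation Fi Fo σ (fun l u => if σ l = q then UnitAddTorus.mFourier (-z) u else 0)
    {i} l X G

/-- The deviation of the codegree of `i` and `j` from its expectation given their positions. -/
noncomputable def codegreeDeviation (Fi Fo : UnitAddTorus (Fin d) → ℝ) (σ : Fin n → Fin k)
    (i j : Fin n) (X : Fin n → UnitAddTorus (Fin d)) (G : SimpleGraph (Fin n)) : ℂ :=
  ∑ l, fluctuation Fi Fo σ (fun _ _ => 1) {i, j} l X G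

/-- The total squared error of the modes in `Z` and of the codegrees. -/
noncomputable def discrepancy (Fi Fo : UnitAddTorus (Fin d) → ℝ) (σ : Fin n → Fin k)
    (Z : Finset (Fin d → ℤ)) (X : Fin n → UnitAddTorus (Fin d)) (G : SimpleGraph (Fin n)) : ℝ :=
  ∑ z ∈ Z, ∑ q, ∑ i, ‖modeResidual Fi Fo σ z q i X G‖ ^ 2
    + ∑ i, ∑ j, (n : ℝ)⁻¹ * ‖codegreeDeviation Fi Fo σ i j X G‖ ^ 2

/-- The conditional mean in `fluctuation` is a convolution with a character, hence a multiple of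
that character at `X i`. -/
theorem modeResidual_eq (hi : IsConnectivity Fi) (ho : IsConnectivity Fo) (σ : Fin n → Fin k)
    (z : Fin d → ℤ) (q : Fin k) (i : Fin n)
    (X : Fin n → UnitAddTorus (Fin d)) (G : SimpleGraph (Fin n)) :
    modeResidual Fi Fo σ z q i X G = ∑ l with σ l = q,
      ((adj G i l : ℂ) * UnitAddTorus.mFourier (-z) (X l)
        - UnitAddTorus.mFourier (-z) (X i) * fourierCoeff (block Fi Fo (σ i) q) z) := by
  rw [modeResidual, Finset.sum_filter]
  refine Finset.sum_congr rfl fun l _ => ?_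
  simp only [fluctuation, Finset.prod_singleton]
  split_ifs with h
  · rw [← h, ← integral_mFourier_mul_sub _ (hi.block ho _ _).even, mul_comm]
  · simp

theorem measurable_mode (σ : Fin n → Fin k) (z : Fin d → ℤ) (q : Fin k) (l : Fin n) :
    Measurable fun u => if σ l = q then UnitAddTorus.mFourier (-z) u else 0 := by
  split_ifs
  · exact (UnitAddTorus.mFourier (-z)).continuous.measurable
  · exact measurable_const

theorem norm_mode_le (σ : Fin n → Fin k) (z : Fin d → ℤ) (q : Fin k) (l : Fin n)
    (u : UnitAddTorus (Fin d)) : ‖if σ l = q then UnitAddTorus.mFourier (-z) u else 0‖ ≤ 1 := by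
  split_ifs
  · rw [norm_mFourier_apply]
  · simp

theorem IsBddObservable.const_mul {Φ : (Fin n → UnitAddTorus (Fin d)) → SimpleGraph (Fin n) → ℝ}
    (hΦ : IsBddObservable Φ) (c : ℝ) : IsBddObservable fun X G => c * Φ X G := by
  obtain ⟨hm, C, hC⟩ := hΦ
  refine ⟨fun G => (hm G).const_mul c, |c| * C, fun X G => ?_⟩
  rw [norm_mul, Real.norm_eq_abs c]
  exact mul_le_mul_of_nonneg_left (hC X G) (abs_nonneg c)

theorem IsBddObservable.add {Φ Ψ : (Fin n → UnitAddTorus (Fin d)) → SimpleGraph (Fin n) → ℝ}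
    (hΦ : IsBddObservable Φ) (hΨ : IsBddObservable Ψ) :
    IsBddObservable fun X G => Φ X G + Ψ X G := by
  obtain ⟨hm, C, hC⟩ := hΦ
  obtain ⟨hm', C', hC'⟩ := hΨ
  exact ⟨fun G => (hm G).add (hm' G), C + C', fun X G => norm_add_le_of_le (hC X G) (hC' X G)⟩

theorem mean_add (hi : IsConnectivity Fi) (ho : IsConnectivity Fo) (σ : Fin n → Fin k)
    {Φ Ψ : (Fin n → UnitAddTorus (Fin d)) → SimpleGraph (Fin n) → ℝ}
    (hΦ : IsBddObservable Φ) (hΨ : IsBddObservable Ψ) :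
    mean Fi Fo σ (fun X G => Φ X G + Ψ X G) = mean Fi Fo σ Φ + mean Fi Fo σ Ψ := by
  simp only [mean, smul_add, Finset.sum_add_distrib]
  exact integral_add (hΦ.integrable hi ho σ) (hΨ.integrable hi ho σ)

theorem mean_const_mul (σ : Fin n → Fin k)
    (Φ : (Fin n → UnitAddTorus (Fin d)) → SimpleGraph (Fin n) → ℝ) (c : ℝ) :
    mean Fi Fo σ (fun X G => c * Φ X G) = c * mean Fi Fo σ Φ := by
  simp only [mean, smul_eq_mul, ← integral_const_mul, Finset.mul_sum]
  simp only [mul_left_comm]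

theorem isBddObservable_sq_norm_modeResidual (hi : IsConnectivity Fi) (ho : IsConnectivity Fo)
    (σ : Fin n → Fin k) (z : Fin d → ℤ) (q : Fin k) (i : Fin n) :
    IsBddObservable fun X G => ‖modeResidual Fi Fo σ z q i X G‖ ^ 2 :=
  isBddObservable_sq_norm_sum_fluctuation hi ho σ (measurable_mode σ z q) (norm_mode_le σ z q) {i}

theorem isBddObservable_sq_norm_codegreeDeviation (hi : IsConnectivity Fi) (ho : IsConnectivity Fo)
    (σ : Fin n → Fin k) (i j : Fin n) :
    IsBddObservable fun X G => ‖codegreeDeviation Fi Fo σ i j X G‖ ^ 2 :=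
  isBddObservable_sq_norm_sum_fluctuation hi ho σ (fun _ => measurable_const) (by simp) {i, j}

theorem isBddObservable_discrepancy (hi : IsConnectivity Fi) (ho : IsConnectivity Fo)
    (σ : Fin n → Fin k) (Z : Finset (Fin d → ℤ)) : IsBddObservable (discrepancy Fi Fo σ Z) :=
  (IsBddObservable.sum _ fun z _ => IsBddObservable.sum _ fun q _ => IsBddObservable.sum _ fun i _ =>
    isBddObservable_sq_norm_modeResidual hi ho σ z q i).add
  (IsBddObservable.sum _ fun i _ => IsBddObservable.sum _ fun j _ =>
    (isBddObservable_sq_norm_codegreeDeviation hi ho σ i j).const_mul _)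

/-- Each mode residual contributes `4 (n + 2n) = 12 n`, each codegree at most `4 (n + 4n) = 20 n`.
The weight `n⁻¹` brings the `n ^ 2` codegrees to the same order `n ^ 2` as the `#Z * k * n`
residuals. -/
theorem mean_discrepancy_le (hi : IsConnectivity Fi) (ho : IsConnectivity Fo)
    (σ : Fin n → Fin k) (Z : Finset (Fin d → ℤ)) :
    mean Fi Fo σ (discrepancy Fi Fo σ Z) ≤ (12 * (#Z * k) + 20) * n ^ 2 := by
  have oR := isBddObservable_sq_norm_modeResidual hi ho σ
  have oD := isBddObservable_sq_norm_codegreeDeviation hi ho σ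
  have oD' := fun i j => (oD i j).const_mul (n : ℝ)⁻¹
  unfold discrepancy
  rw [mean_add hi ho σ
    (IsBddObservable.sum _ fun z _ => IsBddObservable.sum _ fun q _ =>
      IsBddObservable.sum _ fun i _ => oR z q i)
    (IsBddObservable.sum _ fun i _ => IsBddObservable.sum _ fun j _ => oD' i j),
    mean_sum hi ho σ _ fun z _ => IsBddObservable.sum _ fun q _ =>
      IsBddObservable.sum _ fun i _ => oR z q i,
    mean_sum hi ho σ _ fun i _ => IsBddObservable.sum _ fun j _ => oD' i j]
  have h1 : ∀ z q i, mean Fi Fo σ (fun X G => ‖modeResidual Fi Fo σ z q i X G‖ ^ 2) ≤ 12 * n := by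
    intro z q i
    refine (mean_sq_norm_sum_fluctuation_le hi ho σ (measurable_mode σ z q)
      (norm_mode_le σ z q) {i}).trans (le_of_eq ?_)
    rw [Finset.card_singleton]; push_cast; ring
  have h2 : ∀ i j, mean Fi Fo σ (fun X G => (n : ℝ)⁻¹ * ‖codegreeDeviation Fi Fo σ i j X G‖ ^ 2)
      ≤ 20 := by
    intro i j
    have hn : (0 : ℝ) < n := by exact_mod_cast i.pos
    rw [mean_const_mul, inv_mul_le_iff₀ hn]
    refine (mean_sq_norm_sum_fluctuation_le hi ho σ (fun _ => measurable_const)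
      (by simp) {i, j}).trans ?_
    have : (#({i, j} : Finset (Fin n)) : ℝ) ≤ 2 := by exact_mod_cast Finset.card_le_two
    nlinarith
  have h3 : ∑ z ∈ Z, mean Fi Fo σ (fun X G => ∑ q, ∑ i, ‖modeResidual Fi Fo σ z q i X G‖ ^ 2)
      ≤ ∑ _z ∈ Z, ∑ _q : Fin k, ∑ _i : Fin n, (12 * n : ℝ) := by
    refine Finset.sum_le_sum fun z _ => ?_
    rw [mean_sum hi ho σ _ fun q _ => IsBddObservable.sum _ fun i _ => oR z q i]
    refine Finset.sum_le_sum fun q _ => ?_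
    rw [mean_sum hi ho σ _ fun i _ => oR z q i]
    exact Finset.sum_le_sum fun i _ => h1 z q i
  have h4 : ∑ i, mean Fi Fo σ
        (fun X G => ∑ j, (n : ℝ)⁻¹ * ‖codegreeDeviation Fi Fo σ i j X G‖ ^ 2)
      ≤ ∑ _i : Fin n, ∑ _j : Fin n, (20 : ℝ) := by
    refine Finset.sum_le_sum fun i _ => ?_
    rw [mean_sum hi ho σ _ fun j _ => oD' i j]
    exact Finset.sum_le_sum fun j _ => h2 i j
  refine (add_le_add h3 h4).trans (le_of_eq ?_)
  simp only [Finset.sum_const, Finset.card_univ, Fintype.card_fin, nsmul_eq_mul]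
  ring

theorem prob_eq_mean (σ : Fin n → Fin k) (S : Set (SimpleGraph (Fin n))) :
    prob Fi Fo σ S = mean Fi Fo σ fun _ G => S.indicator (1 : SimpleGraph (Fin n) → ℝ) G := by
  classical
  simp only [prob, mean, smul_eq_mul, Set.indicator_apply, Pi.one_apply, mul_ite, mul_one, mul_zero]

theorem isBddObservable_indicator (S : Set (SimpleGraph (Fin n))) :
    IsBddObservable fun (_ : Fin n → UnitAddTorus (Fin d)) G =>
      S.indicator (1 : SimpleGraph (Fin n) → ℝ) G :=
  ⟨fun _ => stronglyMeasurable_const, 1, fun _ _ =>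
    (norm_indicator_le_norm_self _ _).trans (by simp)⟩

theorem mean_const (hi : IsConnectivity Fi) (ho : IsConnectivity Fo) (σ : Fin n → Fin k) (c : ℝ) :
    mean Fi Fo σ (fun _ _ => c) = c := by
  simp [mean, ← Finset.sum_mul, sum_condProb hi ho]

theorem prob_le_one (hi : IsConnectivity Fi) (ho : IsConnectivity Fo) (σ : Fin n → Fin k)
    (S : Set (SimpleGraph (Fin n))) : prob Fi Fo σ S ≤ 1 := by
  rw [prob_eq_mean]
  refine (Real.le_norm_self _).trans (norm_mean_le hi ho σ 1 fun _ _ => ?_)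
  exact (norm_indicator_le_norm_self _ _).trans (by simp)

/-- Markov's inequality, from the pointwise bound `1 ≤ 1_S + t⁻¹ * discrepancy`. The discrepancy
sees the positions while `S` does not, so `h` is required for all positions. -/
theorem one_sub_le_prob (hi : IsConnectivity Fi) (ho : IsConnectivity Fo) (σ : Fin n → Fin k)
    (Z : Finset (Fin d → ℤ)) (S : Set (SimpleGraph (Fin n))) {t : ℝ} (ht : 0 < t)
    (h : ∀ X G, discrepancy Fi Fo σ Z X G < t → G ∈ S) :
    1 - (12 * (#Z * k) + 20) * n ^ 2 / t ≤ prob Fi Fo σ S := by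
  have hobs := isBddObservable_discrepancy hi ho σ Z
  have h1 : mean Fi Fo σ (fun _ _ => (1 : ℝ)) ≤ mean Fi Fo σ fun X G =>
      S.indicator (1 : SimpleGraph (Fin n) → ℝ) G + t⁻¹ * discrepancy Fi Fo σ Z X G := by
    refine mean_mono hi ho σ ⟨fun _ => stronglyMeasurable_const, 1, by simp⟩
      ((isBddObservable_indicator S).add (hobs.const_mul _)) fun X G => ?_
    have h0 : 0 ≤ discrepancy Fi Fo σ Z X G := by unfold discrepancy; positivity
    by_cases hG : G ∈ S
    · simp only [Set.indicator_of_mem hG, Pi.one_apply]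
      have : 0 ≤ t⁻¹ * discrepancy Fi Fo σ Z X G := by positivity
      linarith
    · have h2 : t ≤ discrepancy Fi Fo σ Z X G := not_lt.1 fun h' => hG (h X G h')
      rw [Set.indicator_of_notMem hG, zero_add, inv_mul_eq_div, le_div_iff₀ ht]
      linarith
  rw [mean_const hi ho, mean_add hi ho σ (isBddObservable_indicator S) (hobs.const_mul _),
    ← prob_eq_mean, mean_const_mul] at h1
  have h2 := mul_le_mul_of_nonneg_left (mean_discrepancy_le hi ho σ Z) (inv_nonneg.2 ht.le)
  rw [div_eq_inv_mul]
  linarith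
end

/-! ### The limiting `k × k` eigenvalue equation -/

theorem sq_norm_sum_mul_le {ι : Type*} (s : Finset ι) (f : ι → ℂ) (x : ι → ℝ) :
    ‖∑ i ∈ s, f i * (x i : ℂ)‖ ^ 2 ≤ (∑ i ∈ s, ‖f i‖ ^ 2) * ∑ i ∈ s, x i ^ 2 := by
  have h1 : ‖∑ i ∈ s, f i * (x i : ℂ)‖ ≤ ∑ i ∈ s, ‖f i‖ * |x i| :=
    norm_sum_le_of_le _ fun i _ => by rw [norm_mul, Complex.norm_real, Real.norm_eq_abs]
  have h2 := Finset.sum_mul_sq_le_sq_mul_sq s (fun i => ‖f i‖) (fun i => |x i|)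
  simp only [sq_abs] at h2
  exact (pow_le_pow_left₀ (norm_nonneg _) h1 2).trans h2

/-- Approximate solutions of the `k × k` eigenvalue equation with diagonal entries `a` and
off-diagonal entries `b` are small. -/
theorem sum_norm_le_of_approx_eigenvector {k : ℕ} (t : Fin k → ℂ) (a b c : ℂ) (δ e : ℝ)
    (hδ : 0 < δ) (hδ1 : δ ≤ 1) (hb : ‖b‖ ≤ 1)
    (h1 : δ ≤ ‖c - a - (k - 1) * b‖) (h2 : δ ≤ ‖c - a + b‖ ∨ ∀ p q, t p = t q)
    (h : ∀ q, ‖(∑ p, (if p = q then a else b) * t p) - c * t q‖ ≤ e) :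
    ∑ q, ‖t q‖ ≤ 2 * k ^ 2 * e / δ ^ 2 := by
  rcases Nat.eq_zero_or_pos k with rfl | hk
  · simp
  have he : 0 ≤ e := (norm_nonneg _).trans (h ⟨0, hk⟩)
  have hk1 : (1 : ℝ) ≤ k := by exact_mod_cast hk
  set T := ∑ q, t q with hT
  have hrow : ∀ q, ∑ p, (if p = q then a else b) * t p = (a - b) * t q + b * T := by
    intro q
    have : ∀ p, (if p = q then a else b) * t p = (if p = q then (a - b) * t p else 0) + b * t p := by
      intro p; split_ifs <;> ring
    simp only [this, Finset.sum_add_distrib, Finset.sum_ite_eq', Finset.mem_univ, if_true, hT,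
      Finset.mul_sum]
  -- Summing the equations over `q` isolates the all-ones direction, with eigenvalue `a + (k - 1)
  -- b`.
  have hTb : ‖T‖ ≤ k * e / δ := by
    rw [le_div_iff₀ hδ]
    calc ‖T‖ * δ ≤ ‖T‖ * ‖c - a - (k - 1) * b‖ := by gcongr
      _ = ‖∑ q, ((∑ p, (if p = q then a else b) * t p) - c * t q)‖ := by
          rw [← norm_mul, ← norm_neg]
          congr 1
          simp only [hrow, Finset.sum_sub_distrib, Finset.sum_add_distrib, ← Finset.mul_sum, ← hT,
            Finset.sum_const, Finset.card_univ, Fintype.card_fin, nsmul_eq_mul]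
          ring
      _ ≤ ∑ _q : Fin k, e := norm_sum_le_of_le _ fun q _ => h q
      _ = k * e := by simp
  have hδ2 : δ ^ 2 ≤ δ := by nlinarith
  have hmain : k * e / δ ≤ k * e / δ ^ 2 := by gcongr
  rcases h2 with h2 | h2
  -- With `T` controlled, each single equation reads `(a - b - c) * t q = O(e) - b * T`.
  · have hq : ∀ q, ‖t q‖ ≤ 2 * k * e / δ ^ 2 := by
      intro q
      have h3 : ‖t q‖ * δ ≤ e + k * e / δ := by
        calc ‖t q‖ * δ ≤ ‖t q‖ * ‖c - a + b‖ := by gcongr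
          _ = ‖((∑ p, (if p = q then a else b) * t p) - c * t q) - b * T‖ := by
              rw [← norm_mul, ← norm_neg, hrow]; congr 1; ring
          _ ≤ e + 1 * (k * e / δ) := by
              refine norm_sub_le_of_le (h q) ?_
              rw [norm_mul]; gcongr
          _ = e + k * e / δ := by rw [one_mul]
      rw [le_div_iff₀ (by positivity)]
      have h4 : e ≤ k * e / δ := by
        rw [le_div_iff₀ hδ]; nlinarith
      have h5 : k * e / δ * δ = k * e := by field_simp
      nlinarith
    calc ∑ q, ‖t q‖ ≤ ∑ _q : Fin k, 2 * k * e / δ ^ 2 := Finset.sum_le_sum fun q _ => hq q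
      _ = 2 * k ^ 2 * e / δ ^ 2 := by simp; ring
  · have : ∑ q, ‖t q‖ = ‖T‖ := by
      have hc : ∀ q, t q = t ⟨0, hk⟩ := fun q => h2 _ _
      rw [hT]
      simp only [hc, Finset.sum_const, Finset.card_univ, Fintype.card_fin, nsmul_eq_mul, norm_mul,
        Complex.norm_natCast]
    rw [this]
    refine (hTb.trans hmain).trans ?_
    gcongr
    nlinarith

/-! ### Fourier modes of a weight vector and Parseval -/

section
variable {d n k : ℕ} {Fi Fo : UnitAddTorus (Fin d) → ℝ}

/-- The Fourier mode `z` of the weights `x` of the vertices in the community `q`. -/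
noncomputable def modeSum (σ : Fin n → Fin k) (X : Fin n → UnitAddTorus (Fin d)) (x : Fin n → ℝ)
    (z : Fin d → ℤ) (q : Fin k) : ℂ :=
  ∑ i with σ i = q, UnitAddTorus.mFourier (-z) (X i) * x i

theorem sum_mul_fourierCoeff_block (σ : Fin n → Fin k) (X : Fin n → UnitAddTorus (Fin d))
    (x : Fin n → ℝ) (z : Fin d → ℤ) (q : Fin k) :
    ∑ i, UnitAddTorus.mFourier (-z) (X i) * x i * fourierCoeff (block Fi Fo (σ i) q) z
      = ∑ p, fourierCoeff (block Fi Fo p q) z * modeSum σ X x z p := by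
  rw [← Finset.sum_fiberwise (s := univ) (g := σ)]
  refine Finset.sum_congr rfl fun p _ => ?_
  rw [modeSum, Finset.mul_sum]
  refine Finset.sum_congr rfl fun i hi => ?_
  rw [(Finset.mem_filter.1 hi).2]; ring

/-- The trivial Cauchy–Schwarz bound, used for the frequencies outside `Z`. -/
theorem sum_norm_modeSum_le (σ : Fin n → Fin k) (X : Fin n → UnitAddTorus (Fin d)) (x : Fin n → ℝ)
    (z : Fin d → ℤ) : (∑ q, ‖modeSum σ X x z q‖) ^ 2 ≤ n * ∑ i, x i ^ 2 := by
  have h1 : ∑ q, ‖modeSum σ X x z q‖ ≤ ∑ i, 1 * |x i| := by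
    rw [← Finset.sum_fiberwise (s := univ) (g := σ)]
    refine Finset.sum_le_sum fun q _ => norm_sum_le_of_le _ fun i _ => ?_
    rw [norm_mul, norm_mFourier_apply, Complex.norm_real, Real.norm_eq_abs]
  have h2 := Finset.sum_mul_sq_le_sq_mul_sq univ (fun _ : Fin n => (1 : ℝ)) (fun i => |x i|)
  refine (pow_le_pow_left₀ (by positivity) h1 2).trans (h2.trans (le_of_eq ?_))
  simp

theorem integrable_block_sub (hi : IsConnectivity Fi) (ho : IsConnectivity Fo) (p q : Fin k)
    (y : UnitAddTorus (Fin d)) : Integrable (fun u => block Fi Fo p q (y - u)) (uniformTorus d) :=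
  Integrable.of_bound (C := 1)
    ((hi.block ho p q).measurable.comp (by fun_prop)).aestronglyMeasurable
    (Eventually.of_forall fun u => by
      have := (hi.block ho p q).mem (y - u)
      rw [Real.norm_of_nonneg this.1]; exact this.2)

theorem fourierCoeff_sum_block (hi : IsConnectivity Fi) (ho : IsConnectivity Fo)
    (σ : Fin n → Fin k) (X : Fin n → UnitAddTorus (Fin d)) (x : Fin n → ℝ) (z : Fin d → ℤ)
    (q : Fin k) :
    fourierCoeff (fun u => ∑ i, x i * block Fi Fo (σ i) q (X i - u)) z
      = ∑ p, fourierCoeff (block Fi Fo p q) z * modeSum σ X x z p := by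
  rw [← sum_mul_fourierCoeff_block, fourierCoeff_eq]
  have : ∀ u, UnitAddTorus.mFourier (-z) u *
        ((∑ i, x i * block Fi Fo (σ i) q (X i - u) : ℝ) : ℂ)
      = ∑ i, (x i : ℂ) * (UnitAddTorus.mFourier (-z) u * (block Fi Fo (σ i) q (X i - u) : ℂ)) := by
    intro u
    push_cast
    rw [Finset.mul_sum]
    exact Finset.sum_congr rfl fun i _ => by ring
  simp only [this]
  rw [integral_finsetSum]
  · refine Finset.sum_congr rfl fun i _ => ?_
    rw [integral_const_mul, integral_mFourier_mul_sub _ (hi.block ho _ _).even]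
    ring
  · intro i _
    refine Integrable.const_mul ?_ _
    refine (integrable_block_sub hi ho (σ i) q (X i)).ofReal.bdd_mul (c := 1)
      (UnitAddTorus.mFourier (-z)).continuous.aestronglyMeasurable
      (Eventually.of_forall fun u => (norm_mFourier_apply _ _).le)

/-- Symmetry of `adj G` moves it onto `x`, and balance turns the number of vertices in community `q`
into `n / k`. -/
theorem modeResidual_pairing (hi : IsConnectivity Fi) (ho : IsConnectivity Fo) (σ : Fin n → Fin k)
    (hσ : IsBalanced σ) (X : Fin n → UnitAddTorus (Fin d)) (G : SimpleGraph (Fin n))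
    (x : Fin n → ℝ) (z : Fin d → ℤ) (q : Fin k) (hk : 0 < k) :
    ∑ i, modeResidual Fi Fo σ z q i X G * x i
      = ∑ j with σ j = q, UnitAddTorus.mFourier (-z) (X j) * ((adj G *ᵥ x) j : ℝ)
        - (n / k : ℂ) * ∑ p, fourierCoeff (block Fi Fo p q) z * modeSum σ X x z p := by
  have hcard : ((#{j | σ j = q} : ℕ) : ℂ) = n / k := by
    have h1 : ((k * #{j | σ j = q} : ℕ) : ℂ) = n := by rw [hσ q]
    have : (k : ℂ) ≠ 0 := by exact_mod_cast hk.ne'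
    field_simp
    push_cast at h1
    linear_combination h1
  have h1 : ∀ i, modeResidual Fi Fo σ z q i X G * x i
      = ∑ j with σ j = q, UnitAddTorus.mFourier (-z) (X j) * ((adj G j i : ℂ) * x i)
        - (n / k : ℂ) * (UnitAddTorus.mFourier (-z) (X i) * x i *
            fourierCoeff (block Fi Fo (σ i) q) z) := by
    intro i
    rw [modeResidual_eq hi ho, Finset.sum_sub_distrib, Finset.sum_const, nsmul_eq_mul, hcard,
      sub_mul, Finset.sum_mul]
    congr 1
    · exact Finset.sum_congr rfl fun j _ => by rw [adj_symm]; ring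
    · ring
  simp only [h1]
  rw [Finset.sum_sub_distrib, ← Finset.mul_sum, sum_mul_fourierCoeff_block, Finset.sum_comm]
  congr 1
  refine Finset.sum_congr rfl fun j _ => ?_
  rw [← Finset.mul_sum]
  simp [Matrix.mulVec, dotProduct]

theorem fourierCoeff_block (p q : Fin k) (z : Fin d → ℤ) :
    fourierCoeff (block Fi Fo p q) z = if p = q then fourierCoeff Fi z else fourierCoeff Fo z := by
  unfold block; split_ifs <;> rfl

theorem norm_sum_fourierCoeff_block_sq_le (t : Fin k → ℂ) (z : Fin d → ℤ) (q : Fin k) :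
    ‖∑ p, fourierCoeff (block Fi Fo p q) z * t p‖ ^ 2
      ≤ (‖fourierCoeff Fi z‖ ^ 2 + ‖fourierCoeff Fo z‖ ^ 2) * (∑ p, ‖t p‖) ^ 2 := by
  set m := ‖fourierCoeff Fi z‖ ^ 2 + ‖fourierCoeff Fo z‖ ^ 2 with hm
  have h0 : 0 ≤ m := by positivity
  have h1 : ∀ p, ‖fourierCoeff (block Fi Fo p q) z‖ ≤ √m := by
    intro p
    apply Real.le_sqrt_of_sq_le
    rw [fourierCoeff_block]
    split_ifs <;> nlinarith [sq_nonneg ‖fourierCoeff Fi z‖, sq_nonneg ‖fourierCoeff Fo z‖]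
  have h2 : ‖∑ p, fourierCoeff (block Fi Fo p q) z * t p‖ ≤ √m * ∑ p, ‖t p‖ := by
    rw [Finset.mul_sum]
    refine norm_sum_le_of_le _ fun p _ => ?_
    rw [norm_mul]
    exact mul_le_mul_of_nonneg_right (h1 p) (norm_nonneg _)
  refine (pow_le_pow_left₀ (norm_nonneg _) h2 2).trans (le_of_eq ?_)
  rw [mul_pow, Real.sq_sqrt h0]

/-- Parseval's identity bounds the quadratic form of the autoconvolution of the kernel. -/
theorem integral_sq_sum_block_le (hi : IsConnectivity Fi) (ho : IsConnectivity Fo)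
    (σ : Fin n → Fin k) (X : Fin n → UnitAddTorus (Fin d)) (x : Fin n → ℝ) (hx : ∑ i, x i ^ 2 = 1)
    (q : Fin k) (Z : Finset (Fin d → ℤ)) (M θ : ℝ)
    (hM : HasSum (fun z => ‖fourierCoeff Fi z‖ ^ 2 + ‖fourierCoeff Fo z‖ ^ 2) M)
    (hθ : ∀ z ∈ Z, (∑ p, ‖modeSum σ X x z p‖) ^ 2 ≤ θ * n) :
    ∫ u, (∑ i, x i * block Fi Fo (σ i) q (X i - u)) ^ 2 ∂(uniformTorus d)
      ≤ n * (M - ∑ z ∈ Z, (‖fourierCoeff Fi z‖ ^ 2 + ‖fourierCoeff Fo z‖ ^ 2)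
        + θ * ∑ z ∈ Z, (‖fourierCoeff Fi z‖ ^ 2 + ‖fourierCoeff Fo z‖ ^ 2)) := by
  classical
  set m : (Fin d → ℤ) → ℝ := fun z => ‖fourierCoeff Fi z‖ ^ 2 + ‖fourierCoeff Fo z‖ ^ 2 with hm
  have hm0 : ∀ z, 0 ≤ m z := fun z => by positivity
  have hP := hasSum_sq_fourierCoeff (fun u => ∑ i, x i * block Fi Fo (σ i) q (X i - u))
    (Finset.measurable_fun_sum _ fun i _ =>
      ((hi.block ho _ _).measurable.comp (by fun_prop)).const_mul _) (∑ i, |x i|) fun u => by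
      refine (Finset.abs_sum_le_sum_abs _ _).trans (Finset.sum_le_sum fun i _ => ?_)
      have := (hi.block ho (σ i) q).mem (X i - u)
      rw [abs_mul, abs_of_nonneg this.1]
      exact mul_le_of_le_one_right (abs_nonneg _) this.2
  have hZ : HasSum (fun z => if z ∈ Z then m z else 0) (∑ z ∈ Z, m z) := by
    have : HasSum (fun z => if z ∈ Z then m z else 0) (∑ z ∈ Z, if z ∈ Z then m z else 0) :=
      hasSum_sum_of_ne_finset_zero fun z hz => if_neg hz
    rwa [Finset.sum_congr rfl fun z hz => if_pos hz] at this
  -- Termwise comparison of Parseval's series: the bound `θ * n` on mode sums inside `Z`, the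
  -- trivial bound `n` outside.
  refine hasSum_le (fun z => ?_) hP (((hM.sub hZ).add (hZ.mul_left θ)).mul_left (n : ℝ))
  rw [fourierCoeff_sum_block hi ho]
  refine (norm_sum_fourierCoeff_block_sq_le _ z q).trans ?_
  split_ifs with h
  · have := mul_le_mul_of_nonneg_left (hθ z h) (hm0 z)
    linarith
  · have := mul_le_mul_of_nonneg_left (sum_norm_modeSum_le σ X x z) (hm0 z)
    rw [hx] at this
    linarith
end

/-! ### The square of the adjacency matrix through codegrees -/

section
variable {d n k : ℕ} {Fi Fo : UnitAddTorus (Fin d) → ℝ}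

theorem sum_sq_mulVec_adj (G : SimpleGraph (Fin n)) (x : Fin n → ℝ) :
    ∑ l, (adj G *ᵥ x) l ^ 2 = ∑ i, ∑ j, x i * x j * ∑ l, adj G i l * adj G j l := by
  have h1 : ∀ l, (adj G *ᵥ x) l ^ 2 = ∑ i, ∑ j, x i * x j * (adj G i l * adj G j l) := by
    intro l
    rw [sq, Matrix.mulVec, dotProduct, Finset.sum_mul_sum]
    refine Finset.sum_congr rfl fun i _ => Finset.sum_congr rfl fun j _ => ?_
    rw [adj_symm G l i, adj_symm G l j]; ring
  simp only [h1, Finset.mul_sum]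
  rw [Finset.sum_comm]
  exact Finset.sum_congr rfl fun i _ => Finset.sum_comm

/-- The expected number of common neighbours of `i` and `j` in the direction of `l`. -/
noncomputable def codegreeMean (Fi Fo : UnitAddTorus (Fin d) → ℝ) (σ : Fin n → Fin k)
    (X : Fin n → UnitAddTorus (Fin d)) (i j l : Fin n) : ℝ :=
  ∫ u, block Fi Fo (σ i) (σ l) (X i - u) * block Fi Fo (σ j) (σ l) (X j - u) ∂(uniformTorus d)

theorem integrable_block_mul_block (hi : IsConnectivity Fi) (ho : IsConnectivity Fo)
    (σ : Fin n → Fin k) (X : Fin n → UnitAddTorus (Fin d)) (i j l : Fin n) :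
    Integrable (fun u => block Fi Fo (σ i) (σ l) (X i - u) * block Fi Fo (σ j) (σ l) (X j - u))
      (uniformTorus d) := by
  refine (integrable_block_sub hi ho (σ j) (σ l) (X j)).bdd_mul (c := 1)
    (integrable_block_sub hi ho (σ i) (σ l) (X i)).aestronglyMeasurable
    (Eventually.of_forall fun u => ?_)
  have := (hi.block ho (σ i) (σ l)).mem (X i - u)
  rw [Real.norm_of_nonneg this.1]; exact this.2

theorem codegreeMean_mem (hi : IsConnectivity Fi) (ho : IsConnectivity Fo)
    (σ : Fin n → Fin k) (X : Fin n → UnitAddTorus (Fin d)) (i j l : Fin n) :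
    codegreeMean Fi Fo σ X i j l ∈ Set.Icc (0 : ℝ) 1 := by
  have h1 := fun u => (hi.block ho (σ i) (σ l)).mem (X i - u)
  have h2 := fun u => (hi.block ho (σ j) (σ l)).mem (X j - u)
  refine ⟨integral_nonneg fun u => mul_nonneg (h1 u).1 (h2 u).1, ?_⟩
  refine (integral_mono (integrable_block_mul_block hi ho σ X i j l) (integrable_const 1)
    fun u => mul_le_one₀ (h1 u).2 (h2 u).1 (h2 u).2).trans (by simp)

theorem abs_sum_adj_sub_codegreeMean_le (hi : IsConnectivity Fi) (ho : IsConnectivity Fo)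
    (σ : Fin n → Fin k) (X : Fin n → UnitAddTorus (Fin d)) (G : SimpleGraph (Fin n)) (i j : Fin n) :
    |∑ l, (adj G i l * adj G j l - codegreeMean Fi Fo σ X i j l)|
      ≤ ‖codegreeDeviation Fi Fo σ i j X G‖ + if i = j then (n : ℝ) else 0 := by
  -- For `i = j` the set `{i, j}` is a singleton, so `codegreeDeviation` subtracts the integral of
  -- `F` and not of `F ^ 2`; the trivial bound `n` serves instead.
  split_ifs with h
  · have h1 : |∑ l, (adj G i l * adj G j l - codegreeMean Fi Fo σ X i j l)| ≤ ∑ _l : Fin n, (1 : ℝ) := by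
      refine (Finset.abs_sum_le_sum_abs _ _).trans (Finset.sum_le_sum fun l _ => ?_)
      have h1 := adj_mem G i l
      have h2 := adj_mem G j l
      have h3 := codegreeMean_mem hi ho σ X i j l
      have h4 : adj G i l * adj G j l ≤ 1 := mul_le_one₀ h1.2 h2.1 h2.2
      have h5 : 0 ≤ adj G i l * adj G j l := mul_nonneg h1.1 h2.1
      rw [abs_le]
      constructor <;> linarith [h3.1, h3.2]
    simp only [Finset.sum_const, Finset.card_univ, Fintype.card_fin, nsmul_eq_mul, mul_one] at h1
    linarith [norm_nonneg (codegreeDeviation Fi Fo σ i j X G)]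
  · rw [add_zero]
    have : codegreeDeviation Fi Fo σ i j X G
        = ((∑ l, (adj G i l * adj G j l - codegreeMean Fi Fo σ X i j l) : ℝ) : ℂ) := by
      rw [codegreeDeviation, Complex.ofReal_sum]
      refine Finset.sum_congr rfl fun l _ => ?_
      simp only [fluctuation, Finset.prod_pair h, one_mul, codegreeMean]
      push_cast
      rw [← integral_complex_ofReal]
      push_cast
      rfl
    rw [this, Complex.norm_real, Real.norm_eq_abs]

/-- This is where the codegree form becomes an `L²` norm, to which Parseval applies. -/
theorem sum_mul_codegreeMean (hi : IsConnectivity Fi) (ho : IsConnectivity Fo)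
    (σ : Fin n → Fin k) (X : Fin n → UnitAddTorus (Fin d)) (x : Fin n → ℝ) (l : Fin n) :
    ∑ i, ∑ j, x i * x j * codegreeMean Fi Fo σ X i j l
      = ∫ u, (∑ i, x i * block Fi Fo (σ i) (σ l) (X i - u)) ^ 2 ∂(uniformTorus d) := by
  have hI := integrable_block_mul_block hi ho σ X
  simp only [codegreeMean, ← integral_const_mul]
  simp only [← integral_finsetSum univ fun j _ => (hI _ j l).const_mul _]
  rw [← integral_finsetSum univ fun i _ => integrable_finsetSum univ fun j _ =>
    (hI i j l).const_mul (x i * x j)]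
  refine integral_congr_ae (Eventually.of_forall fun u => ?_)
  simp only
  rw [sq, Finset.sum_mul_sum]
  exact Finset.sum_congr rfl fun i _ => Finset.sum_congr rfl fun j _ => by ring

/-- In `xᵀ A² x` the mean codegrees contribute at most `n * B`, the deviations at most their
Frobenius norm `s`, and the diagonal at most `n`. -/
theorem sum_sq_mulVec_adj_le (hi : IsConnectivity Fi) (ho : IsConnectivity Fo)
    (σ : Fin n → Fin k) (X : Fin n → UnitAddTorus (Fin d)) (G : SimpleGraph (Fin n))
    (x : Fin n → ℝ) (hx : ∑ i, x i ^ 2 = 1) (B s : ℝ) (hs : 0 ≤ s)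
    (hB : ∀ q, ∫ u, (∑ i, x i * block Fi Fo (σ i) q (X i - u)) ^ 2 ∂(uniformTorus d) ≤ B)
    (hD : ∑ i, ∑ j, ‖codegreeDeviation Fi Fo σ i j X G‖ ^ 2 ≤ s ^ 2) :
    ∑ l, (adj G *ᵥ x) l ^ 2 ≤ n * B + s + n := by
  have h1 : ∑ l, (adj G *ᵥ x) l ^ 2
      = ∑ i, ∑ j, x i * x j * ∑ l, (adj G i l * adj G j l - codegreeMean Fi Fo σ X i j l)
        + ∑ l, ∑ i, ∑ j, x i * x j * codegreeMean Fi Fo σ X i j l := by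
    rw [sum_sq_mulVec_adj]
    have : ∑ l, ∑ i, ∑ j, x i * x j * codegreeMean Fi Fo σ X i j l
        = ∑ i, ∑ j, x i * x j * ∑ l, codegreeMean Fi Fo σ X i j l := by
      rw [Finset.sum_comm]
      refine Finset.sum_congr rfl fun i _ => ?_
      rw [Finset.sum_comm]
      simp only [Finset.mul_sum]
    rw [this]
    simp only [← Finset.sum_add_distrib]
    refine Finset.sum_congr rfl fun i _ => Finset.sum_congr rfl fun j _ => ?_
    rw [Finset.sum_sub_distrib]; ring
  have h2 : ∑ l, ∑ i, ∑ j, x i * x j * codegreeMean Fi Fo σ X i j l ≤ n * B := by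
    calc _ ≤ ∑ _l : Fin n, B := Finset.sum_le_sum fun l _ => by
          rw [sum_mul_codegreeMean hi ho]; exact hB _
      _ = n * B := by simp
  have h3 : ∑ i, ∑ j, x i * x j * ∑ l, (adj G i l * adj G j l - codegreeMean Fi Fo σ X i j l)
      ≤ ∑ i, ∑ j, (|x i * x j| * ‖codegreeDeviation Fi Fo σ i j X G‖
        + if i = j then x i ^ 2 * n else 0) := by
    refine Finset.sum_le_sum fun i _ => Finset.sum_le_sum fun j _ => ?_
    refine (le_abs_self _).trans ?_
    rw [abs_mul]
    refine (mul_le_mul_of_nonneg_left (abs_sum_adj_sub_codegreeMean_le hi ho σ X G i j)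
      (abs_nonneg _)).trans (le_of_eq ?_)
    split_ifs with h
    · subst h; rw [mul_add, ← sq, abs_of_nonneg (sq_nonneg _)]
    · simp
  have h4 : ∑ i, ∑ j, (|x i * x j| * ‖codegreeDeviation Fi Fo σ i j X G‖
        + if i = j then x i ^ 2 * n else 0)
      = ∑ i, ∑ j, |x i * x j| * ‖codegreeDeviation Fi Fo σ i j X G‖ + n := by
    simp only [Finset.sum_add_distrib, Finset.sum_ite_eq, Finset.mem_univ, if_true,
      ← Finset.sum_mul, hx, one_mul]
  have h5 : ∑ i, ∑ j, |x i * x j| * ‖codegreeDeviation Fi Fo σ i j X G‖ ≤ s := by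
    simp only [← Finset.sum_product'] at hD ⊢
    have := Finset.sum_mul_sq_le_sq_mul_sq (univ ×ˢ univ : Finset (Fin n × Fin n))
      (fun p => |x p.1 * x p.2|) (fun p => ‖codegreeDeviation Fi Fo σ p.1 p.2 X G‖)
    have h6 : ∑ p ∈ (univ ×ˢ univ : Finset (Fin n × Fin n)), |x p.1 * x p.2| ^ 2 = 1 := by
      rw [Finset.sum_product]
      simp only [sq_abs, mul_pow, ← Finset.mul_sum, hx, mul_one]
    rw [h6, one_mul] at this
    exact le_of_sq_le_sq (this.trans hD) hs
  linarith

/-- A real number that keeps a positive distance from finitely many others. -/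
theorem exists_pos_le_of_ne_zero {ι : Type*} (s : Finset ι) (f : ι → ℂ) (h : ∀ i ∈ s, f i ≠ 0) :
    ∃ δ : ℝ, 0 < δ ∧ δ ≤ 1 ∧ ∀ i ∈ s, δ ≤ ‖f i‖ := by
  classical
  induction s using Finset.induction_on with
  | empty => exact ⟨1, one_pos, le_rfl, by simp⟩
  | insert a s _ ih =>
    obtain ⟨δ, h0, h1, h2⟩ := ih fun i hi => h i (Finset.mem_insert_of_mem hi)
    refine ⟨min δ ‖f a‖, lt_min h0 (norm_pos_iff.2 (h a (Finset.mem_insert_self a s))),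
      (min_le_left _ _).trans h1, fun i hi => ?_⟩
    rcases Finset.mem_insert.1 hi with rfl | hi
    · exact min_le_right _ _
    · exact (min_le_left _ _).trans (h2 i hi)
end

/-! ### The spectral gap -/

section
variable {d n k : ℕ} {Fi Fo : UnitAddTorus (Fin d) → ℝ}

theorem IsConnectivity.hasSum_sq_fourierCoeff {F : UnitAddTorus (Fin d) → ℝ}
    (hF : IsConnectivity F) :
    HasSum (fun z => ‖fourierCoeff F z‖ ^ 2) (∫ x, F x ^ 2 ∂(uniformTorus d)) :=
  SGBM.hasSum_sq_fourierCoeff F hF.measurable 1 fun x => by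
    rw [abs_of_nonneg (hF.mem x).1]; exact (hF.mem x).2

theorem IsConnectivity.integral_sq_le_one {F : UnitAddTorus (Fin d) → ℝ}
    (hF : IsConnectivity F) : ∫ x, F x ^ 2 ∂(uniformTorus d) ≤ 1 := by
  refine (Real.le_norm_self _).trans
    ((norm_integral_le_of_norm_le_const (C := 1) (Eventually.of_forall fun x => ?_)).trans (by simp))
  have := hF.mem x
  rw [Real.norm_of_nonneg (sq_nonneg _)]
  exact pow_le_one₀ this.1 this.2

theorem IsConnectivity.density_le_one {F : UnitAddTorus (Fin d) → ℝ}
    (hF : IsConnectivity F) : density F ≤ 1 := by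
  have := norm_fourierCoeff_le F hF.mem 0
  rw [fourierCoeff_zero, Complex.norm_real] at this
  exact (Real.le_norm_self _).trans this

theorem IsConnectivity.density_nonneg {F : UnitAddTorus (Fin d) → ℝ}
    (hF : IsConnectivity F) : 0 ≤ density F :=
  integral_nonneg fun x => (hF.mem x).1

theorem discrepancy_mode_le (σ : Fin n → Fin k) (Z : Finset (Fin d → ℤ))
    (X : Fin n → UnitAddTorus (Fin d)) (G : SimpleGraph (Fin n)) {z : Fin d → ℤ} (hz : z ∈ Z) :
    ∑ q, ∑ i, ‖modeResidual Fi Fo σ z q i X G‖ ^ 2 ≤ discrepancy Fi Fo σ Z X G := by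
  have h1 := Finset.single_le_sum
    (f := fun z => ∑ q, ∑ i, ‖modeResidual Fi Fo σ z q i X G‖ ^ 2)
    (fun _ _ => by positivity) hz
  have h2 : 0 ≤ ∑ i, ∑ j, (n : ℝ)⁻¹ * ‖codegreeDeviation Fi Fo σ i j X G‖ ^ 2 := by positivity
  unfold discrepancy
  linarith

theorem sum_sq_codegreeDeviation_le (σ : Fin n → Fin k) (Z : Finset (Fin d → ℤ))
    (X : Fin n → UnitAddTorus (Fin d)) (G : SimpleGraph (Fin n)) (hn : 0 < n) :
    ∑ i, ∑ j, ‖codegreeDeviation Fi Fo σ i j X G‖ ^ 2 ≤ n * discrepancy Fi Fo σ Z X G := by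
  have hn' : (0 : ℝ) < n := by exact_mod_cast hn
  have h1 : 0 ≤ ∑ z ∈ Z, ∑ q, ∑ i, ‖modeResidual Fi Fo σ z q i X G‖ ^ 2 := by positivity
  rw [← inv_mul_le_iff₀ hn']
  simp only [Finset.mul_sum]
  unfold discrepancy
  linarith

/-- If the discrepancy is small, the Fourier modes of an approximate eigenvector approximately
solve the limiting eigenvalue equation. -/
theorem norm_modeSum_equation_le (hi : IsConnectivity Fi) (ho : IsConnectivity Fo)
    (σ : Fin n → Fin k) (hσ : IsBalanced σ) (hk : 0 < k) (hn : 0 < n)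
    (X : Fin n → UnitAddTorus (Fin d)) (G : SimpleGraph (Fin n)) (Z : Finset (Fin d → ℤ))
    (x : Fin n → ℝ) (hx : ∑ i, x i ^ 2 = 1) (μ ε : ℝ) (hε : 0 ≤ ε)
    (hr : ∑ i, ((adj G *ᵥ x) i - μ / k * n * x i) ^ 2 ≤ (ε * n) ^ 2)
    (hS : discrepancy Fi Fo σ Z X G ≤ ε ^ 2 * n ^ 3) {z : Fin d → ℤ} (hz : z ∈ Z) (q : Fin k) :
    ‖(∑ p, fourierCoeff (block Fi Fo p q) z * modeSum σ X x z p) - μ * modeSum σ X x z q‖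
      ≤ 2 * k * ε * √n := by
  have hn' : (0 : ℝ) < n := by exact_mod_cast hn
  have hk' : (0 : ℝ) < k := by exact_mod_cast hk
  have hs : (ε * n * √n) ^ 2 = ε ^ 2 * n ^ 3 := by
    rw [mul_pow, mul_pow, Real.sq_sqrt hn'.le]; ring
  set r : Fin n → ℝ := fun i => (adj G *ᵥ x) i - μ / k * n * x i with hrdef
  set u := ∑ j with σ j = q, UnitAddTorus.mFourier (-z) (X j) * (r j : ℂ) with hu
  set v := ∑ i, modeResidual Fi Fo σ z q i X G * (x i : ℂ) with hv
  -- Cauchy–Schwarz against a character on at most `n` vertices; for `v` the same bound comes from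
  -- the discrepancy.
  have hub : ‖u‖ ≤ ε * n * √n := by
    refine le_of_sq_le_sq ?_ (by positivity)
    refine (sq_norm_sum_mul_le _ _ _).trans ?_
    rw [hs]
    simp only [norm_mFourier_apply, one_pow, Finset.sum_const, nsmul_eq_mul, mul_one]
    have h1 : ((#{j | σ j = q} : ℕ) : ℝ) ≤ n := by
      exact_mod_cast (Finset.card_le_univ _).trans (by simp)
    have h2 : ∑ i with σ i = q, r i ^ 2 ≤ (ε * n) ^ 2 :=
      (Finset.sum_le_sum_of_subset_of_nonneg (Finset.subset_univ _)
        fun i _ _ => sq_nonneg (r i)).trans hr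
    calc _ ≤ (n : ℝ) * (ε * n) ^ 2 := by gcongr
      _ = _ := by ring
  have hvb : ‖v‖ ≤ ε * n * √n := by
    refine le_of_sq_le_sq ?_ (by positivity)
    refine (sq_norm_sum_mul_le _ _ _).trans ?_
    rw [hs, hx, mul_one]
    have h1 := Finset.single_le_sum (f := fun q => ∑ i, ‖modeResidual Fi Fo σ z q i X G‖ ^ 2)
      (fun _ _ => by positivity) (Finset.mem_univ q)
    exact h1.trans ((discrepancy_mode_le σ Z X G hz).trans hS)
  have hpair := modeResidual_pairing hi ho σ hσ X G x z q hk
  have hsplit : ∑ j with σ j = q, UnitAddTorus.mFourier (-z) (X j) * ((adj G *ᵥ x) j : ℝ)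
      = u + (μ / k * n : ℂ) * modeSum σ X x z q := by
    rw [hu, modeSum, Finset.mul_sum, ← Finset.sum_add_distrib]
    refine Finset.sum_congr rfl fun j _ => ?_
    simp only [hrdef]
    push_cast
    ring
  have hkc : (k : ℂ) ≠ 0 := by exact_mod_cast hk.ne'
  have hnc : (n : ℂ) ≠ 0 := by exact_mod_cast hn.ne'
  have heq : (∑ p, fourierCoeff (block Fi Fo p q) z * modeSum σ X x z p) - μ * modeSum σ X x z q
      = ((k / n : ℝ) : ℂ) * (u - v) := by
    rw [hsplit] at hpair
    rw [hv, hpair]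
    push_cast
    field_simp
    ring
  rw [heq, norm_mul, Complex.norm_real, Real.norm_of_nonneg (by positivity)]
  calc (k / n : ℝ) * ‖u - v‖ ≤ k / n * (ε * n * √n + ε * n * √n) := by
        gcongr
        exact norm_sub_le_of_le hub hvb
    _ = 2 * k * ε * √n := by field_simp; ring

/-- Away from the vectors that separate the communities, the adjacency matrix has no approximate
eigenvector for the eigenvalue `μ n / k`. -/
theorem exists_spectral_gap (hk : 2 ≤ k) (hi : IsConnectivity Fi) (ho : IsConnectivity Fo)
    (hμ : density Fo < density Fi)
    (hsum : ∀ z : Fin d → ℤ, fourierCoeff Fi z + ((k : ℂ) - 1) * fourierCoeff Fo z ≠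
        ((density Fi - density Fo : ℝ) : ℂ))
    (hdiff : ∀ z : Fin d → ℤ, z ≠ 0 → fourierCoeff Fi z - fourierCoeff Fo z ≠
        ((density Fi - density Fo : ℝ) : ℂ)) :
    ∃ ε : ℝ, 0 < ε ∧ ∃ Z : Finset (Fin d → ℤ), 0 ∈ Z ∧ ∀ (n : ℕ) (_ : 1 ≤ ε ^ 4 * n)
      (σ : Fin n → Fin k) (_ : IsBalanced σ) (X : Fin n → UnitAddTorus (Fin d))
      (G : SimpleGraph (Fin n)) (_ : discrepancy Fi Fo σ Z X G ≤ ε ^ 4 * n ^ 3)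
      (x : Fin n → ℝ) (_ : ∑ i, x i ^ 2 = 1)
      (_ : ∀ p q, ∑ i with σ i = p, x i = ∑ i with σ i = q, x i),
      (ε * n) ^ 2 ≤ ∑ i, ((adj G *ᵥ x) i - (density Fi - density Fo) / k * n * x i) ^ 2 := by
  classical
  set μ := density Fi - density Fo with hμdef
  have hμ0 : 0 < μ := sub_pos.2 hμ
  have hμ1 : μ ≤ 1 := by linarith [hi.density_le_one, ho.density_nonneg]
  have hk0 : 0 < k := by omega
  have hk2 : (2 : ℝ) ≤ k := by exact_mod_cast hk
  set c := μ / k with hc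
  have hc0 : 0 < c := by positivity
  have hc1 : c ≤ 1 := by rw [hc, div_le_one (by positivity)]; linarith
  have hM := hi.hasSum_sq_fourierCoeff.add ho.hasSum_sq_fourierCoeff
  set M := ∫ x, Fi x ^ 2 ∂(uniformTorus d) + ∫ x, Fo x ^ 2 ∂(uniformTorus d) with hMdef
  have hM2 : M ≤ 2 := by linarith [hi.integral_sq_le_one, ho.integral_sq_le_one]
  -- `Z` carries all but `c ^ 2 / 8` of the Fourier mass and contains `0`, the frequency needed for
  -- the eigenvectors of `B_σ`.
  obtain ⟨Z, hZ, hZ0⟩ := ((hM.eventually (lt_mem_nhds (show M - c ^ 2 / 8 < M by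
    have : 0 < c ^ 2 := by positivity
    linarith))).and (eventually_ge_atTop {0})).exists
  have hZ0 : (0 : Fin d → ℤ) ∈ Z := hZ0 (Finset.mem_singleton_self 0)
  obtain ⟨δ₁, hδ₁, hδ₁1, hZ1⟩ := exists_pos_le_of_ne_zero Z
    (fun z => (μ : ℂ) - fourierCoeff Fi z - (k - 1) * fourierCoeff Fo z)
    (fun z _ h => hsum z (by linear_combination -h))
  obtain ⟨δ₂, hδ₂, hδ₂1, hZ2⟩ := exists_pos_le_of_ne_zero (Z.erase 0)
    (fun z => (μ : ℂ) - fourierCoeff Fi z + fourierCoeff Fo z)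
    (fun z hz h => hdiff z (Finset.ne_of_mem_erase hz) (by linear_combination -h))
  set δ := min δ₁ δ₂ with hδdef
  have hδ : 0 < δ := lt_min hδ₁ hδ₂
  have hδ1 : δ ≤ 1 := (min_le_left _ _).trans hδ₁1
  -- The second entry makes the mode sums over `Z` at most `c / 4 * √n`; the first makes `6 * ε ^ 2
  -- < c ^ 2 / 2` at the end.
  set ε := min (c / 10) (c * δ ^ 2 / (16 * k ^ 3)) with hεdef
  have hε : 0 < ε := lt_min (by positivity) (by positivity)
  have hεc : ε ≤ c / 10 := min_le_left _ _
  have hεδ : ε * (16 * k ^ 3) ≤ c * δ ^ 2 :=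
    (le_div_iff₀ (by positivity)).1 (min_le_right (c / 10) (c * δ ^ 2 / (16 * k ^ 3)))
  have hε1 : ε ≤ 1 := by linarith
  have hε42 : ε ^ 4 ≤ ε ^ 2 := pow_le_pow_of_le_one hε.le hε1 (by norm_num)
  refine ⟨ε, hε, Z, hZ0, fun n hn σ hσ X G hS x hx hxσ => ?_⟩
  by_contra! hr
  have hn0 : 0 < n := by
    rcases Nat.eq_zero_or_pos n with rfl | h
    · simp at hn; linarith
    · exact h
  have hn' : (0 : ℝ) < n := by exact_mod_cast hn0
  have hS2 : discrepancy Fi Fo σ Z X G ≤ ε ^ 2 * n ^ 3 := hS.trans (by gcongr)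
  have hmode : ∀ z ∈ Z, (∑ p, ‖modeSum σ X x z p‖) ^ 2 ≤ c ^ 2 / 16 * n := by
    intro z hz
    have h1 : ∑ p, ‖modeSum σ X x z p‖ ≤ 2 * k ^ 2 * (2 * k * ε * √n) / δ ^ 2 := by
      refine sum_norm_le_of_approx_eigenvector _ (fourierCoeff Fi z) (fourierCoeff Fo z) μ δ _
        hδ hδ1 (norm_fourierCoeff_le Fo ho.mem z) ((min_le_left _ _).trans (hZ1 z hz)) ?_ ?_
      · by_cases h0 : z = 0
        -- At `z = 0` the difference of the coefficients equals `μ`, but the mode sums are the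
        -- community sums of `x`, which are all equal.
        · right
          intro p q
          have := congrArg (fun r : ℝ => (r : ℂ)) (hxσ p q)
          push_cast at this
          simpa [modeSum, h0, UnitAddTorus.mFourier_zero] using this
        · exact Or.inl ((min_le_right _ _).trans (hZ2 z (Finset.mem_erase.2 ⟨h0, hz⟩)))
      · intro q
        have := norm_modeSum_equation_le hi ho σ hσ hk0 hn0 X G Z x hx μ ε hε.le hr.le hS2 hz q
        simpa only [fourierCoeff_block] using this
    have h2 : 2 * k ^ 2 * (2 * k * ε * √n) / δ ^ 2 ≤ c / 4 * √n := by
      rw [div_le_iff₀ (by positivity)]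
      have := mul_le_mul_of_nonneg_right hεδ (Real.sqrt_nonneg n)
      linarith
    refine (pow_le_pow_left₀ (by positivity) (h1.trans h2) 2).trans (le_of_eq ?_)
    rw [mul_pow, Real.sq_sqrt hn'.le]; ring
  have hB : ∀ q, ∫ u, (∑ i, x i * block Fi Fo (σ i) q (X i - u)) ^ 2 ∂(uniformTorus d)
      ≤ n * (c ^ 2 / 4) := by
    intro q
    refine (integral_sq_sum_block_le hi ho σ X x hx q Z M (c ^ 2 / 16) hM hmode).trans ?_
    have hle := sum_le_hasSum Z (fun z _ => by positivity) hM
    gcongr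
    -- Tail `c ^ 2 / 8`, plus `c ^ 2 / 16` times a mass of at most `M ≤ 2`.
    nlinarith [sq_nonneg c]
  have hA := sum_sq_mulVec_adj_le hi ho σ X G x hx _ (ε ^ 2 * n ^ 2) (by positivity) hB
    ((sum_sq_codegreeDeviation_le σ Z X G hn0).trans
      ((mul_le_mul_of_nonneg_left hS hn'.le).trans (le_of_eq (by ring))))
  have hnn : (n : ℝ) ≤ ε ^ 2 * n ^ 2 := by
    calc (n : ℝ) ≤ ε ^ 4 * n * n := by nlinarith
      _ ≤ ε ^ 2 * n * n := by gcongr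
      _ = _ := by ring
  -- A vector with small residual has `‖A x‖` close to `c * n`, against the bound `hA`.
  have hlam : (c * n) ^ 2 ≤ 2 * ∑ i, (adj G *ᵥ x) i ^ 2
      + 2 * ∑ i, ((adj G *ᵥ x) i - c * n * x i) ^ 2 := by
    calc (c * n) ^ 2 = ∑ i, (c * n * x i) ^ 2 := by
          simp only [mul_pow, ← Finset.mul_sum, hx, mul_one]
      _ ≤ ∑ i, (2 * (adj G *ᵥ x) i ^ 2 + 2 * ((adj G *ᵥ x) i - c * n * x i) ^ 2) :=
          Finset.sum_le_sum fun i _ => by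
            nlinarith [sq_nonneg (2 * (adj G *ᵥ x) i - c * n * x i)]
      _ = _ := by rw [Finset.sum_add_distrib, Finset.mul_sum, Finset.mul_sum]
  have hε2 : ε ^ 2 ≤ c ^ 2 / 100 := by
    calc ε ^ 2 ≤ (c / 10) ^ 2 := by gcongr
      _ = _ := by ring
  have hn2 : 0 < (n : ℝ) ^ 2 := by positivity
  have hc2 : 0 < c ^ 2 := by positivity
  have h3 : c ^ 2 * n ^ 2 ≤ n ^ 2 * (c ^ 2 / 2 + 6 * ε ^ 2) := by nlinarith
  have h4 : c ^ 2 ≤ c ^ 2 / 2 + 6 * ε ^ 2 := by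
    rw [mul_comm] at h3; exact le_of_mul_le_mul_left h3 hn2
  linarith
end

/-! ### Perturbation of eigenvectors and the Procrustes problem -/

section
variable {n r : ℕ}

theorem mulVec_dotProduct_eq (V : Matrix (Fin n) (Fin r) ℝ) (c : Fin r → ℝ) (y : Fin n → ℝ) :
    (V *ᵥ c) ⬝ᵥ y = c ⬝ᵥ (Vᵀ *ᵥ y) := by
  rw [Matrix.dotProduct_mulVec, Matrix.vecMul_transpose]

theorem IsOrthonormalEigenvectors.mul_eq {M : Matrix (Fin n) (Fin n) ℝ} {ev : Fin r → ℝ}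
    {V : Matrix (Fin n) (Fin r) ℝ} (hV : IsOrthonormalEigenvectors M ev V) :
    M * V = V * Matrix.diagonal ev := by
  ext i j
  have := congrFun (hV.2 j) i
  rw [Matrix.mul_diagonal, mul_comm]
  simpa [Matrix.mul_apply, Matrix.mulVec, dotProduct] using this

theorem dotProduct_self_mulVec_add_smul {V : Matrix (Fin n) (Fin r) ℝ} (hV : Vᵀ * V = 1)
    {w : Fin n → ℝ} (hw : Vᵀ *ᵥ w = 0) (c : Fin r → ℝ) (a : ℝ) :
    (V *ᵥ c + a • w) ⬝ᵥ (V *ᵥ c + a • w) = c ⬝ᵥ c + a ^ 2 * (w ⬝ᵥ w) := by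
  have h1 : (V *ᵥ c) ⬝ᵥ (V *ᵥ c) = c ⬝ᵥ c := by
    rw [mulVec_dotProduct_eq, Matrix.mulVec_mulVec, hV, Matrix.one_mulVec]
  have h2 : (V *ᵥ c) ⬝ᵥ w = 0 := by rw [mulVec_dotProduct_eq, hw, dotProduct_zero]
  simp only [add_dotProduct, dotProduct_add, smul_dotProduct, dotProduct_smul, h1, h2,
    dotProduct_comm w, smul_eq_mul]
  ring

/-- If `M - c` is bounded below by `g` on a subspace of codimension at most `r`, an eigenvector
of `M` orthogonal to `r` eigenvectors closest to `c` has its eigenvalue at distance at least `g`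
from `c`. -/
theorem IsClosestEigenvectors.le_abs_sub {M : Matrix (Fin n) (Fin n) ℝ} {c g : ℝ}
    {V : Matrix (Fin n) (Fin r) ℝ} (hV : IsClosestEigenvectors M c V)
    (L : (Fin n → ℝ) →ₗ[ℝ] (Fin r → ℝ))
    (hL : ∀ x, L x = 0 → g ^ 2 * (x ⬝ᵥ x) ≤ (M *ᵥ x - c • x) ⬝ᵥ (M *ᵥ x - c • x))
    {ν : ℝ} {w : Fin n → ℝ} (hw0 : w ≠ 0) (hw : M *ᵥ w = ν • w) (hwV : Vᵀ *ᵥ w = 0) :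
    g ≤ |ν - c| := by
  obtain ⟨ev, hev, hcl⟩ := hV
  have hcl' := hcl ν w hw0 hw fun j => congrFun hwV j
  by_contra! hlt
  -- The columns of `V` and `w` span `r + 1` dimensions, so some nonzero combination lies in the
  -- kernel of `L`. On this span `M - c` stretches by at most `|ν - c|`, because the eigenvalues of
  -- `V` are at least as close to `c`.
  let Φ : (Fin r → ℝ) × ℝ →ₗ[ℝ] (Fin r → ℝ) :=
    L ∘ₗ ((Matrix.mulVecLin V).coprod (LinearMap.toSpanSingleton ℝ _ w))
  have hker : LinearMap.ker Φ ≠ ⊥ := LinearMap.ker_ne_bot_of_finrank_lt (by simp)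
  obtain ⟨⟨b, a⟩, hmem, hne⟩ := (Submodule.ne_bot_iff _).1 hker
  have hLx : L (V *ᵥ b + a • w) = 0 := by simpa [Φ] using hmem
  have h1 := hL _ hLx
  have hres : M *ᵥ (V *ᵥ b + a • w) - c • (V *ᵥ b + a • w)
      = V *ᵥ (fun j => (ev j - c) * b j) + (a * (ν - c)) • w := by
    have : M *ᵥ (V *ᵥ b) = V *ᵥ (fun j => ev j * b j) := by
      rw [Matrix.mulVec_mulVec, hev.mul_eq, ← Matrix.mulVec_mulVec]
      congr 1
      ext j; rw [Matrix.mulVec_diagonal]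
    rw [Matrix.mulVec_add, Matrix.mulVec_smul, this, hw]
    have h2 : (fun j => (ev j - c) * b j) = (fun j => ev j * b j) - c • b := by
      ext j; simp only [Pi.sub_apply, Pi.smul_apply, smul_eq_mul]; ring
    rw [h2, Matrix.mulVec_sub, Matrix.mulVec_smul]
    module
  rw [hres, dotProduct_self_mulVec_add_smul hev.1 hwV, dotProduct_self_mulVec_add_smul hev.1 hwV]
    at h1
  have hww : 0 < w ⬝ᵥ w :=
    lt_of_le_of_ne (Finset.sum_nonneg fun i _ => mul_self_nonneg _)
      fun h => hw0 (dotProduct_self_eq_zero.1 h.symm)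
  set D := (ν - c) ^ 2 with hD
  have hDg : D < g ^ 2 := by
    rw [hD, ← sq_abs]; exact pow_lt_pow_left₀ hlt (abs_nonneg _) two_ne_zero
  have h3 : (fun j => (ev j - c) * b j) ⬝ᵥ (fun j => (ev j - c) * b j) ≤ D * (b ⬝ᵥ b) := by
    simp only [dotProduct, Finset.mul_sum]
    refine Finset.sum_le_sum fun j _ => ?_
    have : (ev j - c) ^ 2 ≤ D := by
      rw [hD, ← sq_abs, ← sq_abs (ν - c)]; exact pow_le_pow_left₀ (abs_nonneg _) (hcl' j) 2
    nlinarith [mul_self_nonneg (b j)]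
  have hbb : 0 ≤ b ⬝ᵥ b := Finset.sum_nonneg fun i _ => mul_self_nonneg _
  have h4 : (g ^ 2 - D) * (b ⬝ᵥ b + a ^ 2 * (w ⬝ᵥ w)) ≤ 0 := by
    rw [mul_pow] at h1
    nlinarith
  have h5 : b ⬝ᵥ b + a ^ 2 * (w ⬝ᵥ w) ≤ 0 := by
    by_contra! h
    exact absurd h4 (not_le.2 (mul_pos (sub_pos.2 hDg) h))
  have haw : 0 ≤ a ^ 2 * (w ⬝ᵥ w) := by positivity
  have hb0 : b = 0 := dotProduct_self_eq_zero.1 (le_antisymm (by linarith) hbb)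
  have ha0 : a = 0 := by
    have : a ^ 2 * (w ⬝ᵥ w) = 0 := le_antisymm (by linarith) haw
    simpa [hww.ne'] using this
  exact hne (by rw [hb0, ha0]; rfl)

theorem inner_toLp_eq_dotProduct (x y : Fin n → ℝ) :
    inner ℝ (WithLp.toLp 2 x) (WithLp.toLp 2 y) = x ⬝ᵥ y := by
  rw [EuclideanSpace.inner_eq_star_dotProduct]
  simp [dotProduct_comm]

theorem dotProduct_self_eq_sum_eigenvectorBasis {M : Matrix (Fin n) (Fin n) ℝ}
    (hM : M.IsHermitian) (y : Fin n → ℝ) :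
    y ⬝ᵥ y = ∑ i, ((hM.eigenvectorBasis i).ofLp ⬝ᵥ y) ^ 2 := by
  have h := hM.eigenvectorBasis.sum_sq_norm_inner_right (WithLp.toLp 2 y)
  have h2 : ‖WithLp.toLp 2 y‖ ^ 2 = y ⬝ᵥ y := by
    rw [← real_inner_self_eq_norm_sq, inner_toLp_eq_dotProduct]
  rw [← h2, ← h]
  refine Finset.sum_congr rfl fun i _ => ?_
  rw [Real.norm_eq_abs, sq_abs, ← inner_toLp_eq_dotProduct]

/-- The operator `M - c` is bounded below on the orthogonal complement of a family of
eigenvectors, if it is so at the eigenvectors in the complement. -/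
theorem sq_mul_dotProduct_le_of_eigenvector_bound {M : Matrix (Fin n) (Fin n) ℝ}
    (hM : M.IsHermitian) {ev : Fin r → ℝ} {V : Matrix (Fin n) (Fin r) ℝ}
    (hV : IsOrthonormalEigenvectors M ev V) {c g : ℝ} (hg : 0 ≤ g)
    (h : ∀ (ν : ℝ) (w : Fin n → ℝ), w ≠ 0 → M *ᵥ w = ν • w → Vᵀ *ᵥ w = 0 → g ≤ |ν - c|)
    {y : Fin n → ℝ} (hy : Vᵀ *ᵥ y = 0) :
    g ^ 2 * (y ⬝ᵥ y) ≤ (M *ᵥ y - c • y) ⬝ᵥ (M *ᵥ y - c • y) := by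
  have hMt : Mᵀ = M := by simpa [Matrix.IsHermitian] using hM
  rw [dotProduct_self_eq_sum_eigenvectorBasis hM, dotProduct_self_eq_sum_eigenvectorBasis hM,
    Finset.mul_sum]
  refine Finset.sum_le_sum fun i _ => ?_
  set b := (hM.eigenvectorBasis i).ofLp with hb
  set ν := hM.eigenvalues i
  have hMb : M *ᵥ b = ν • b := hM.mulVec_eigenvectorBasis i
  have h1 : b ⬝ᵥ (M *ᵥ y - c • y) = (ν - c) * (b ⬝ᵥ y) := by
    have : b ⬝ᵥ (M *ᵥ y) = ν * (b ⬝ᵥ y) := by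
      rw [Matrix.dotProduct_mulVec, ← Matrix.mulVec_transpose, hMt, hMb, smul_dotProduct,
        smul_eq_mul]
    rw [dotProduct_sub, this, dotProduct_smul, smul_eq_mul]; ring
  rw [h1, mul_pow]
  -- The eigenbasis of `M` need not be adapted to `V`. Removing the component along `V` leaves zero
  -- or an eigenvector for the same `ν`, with the same pairing with `y`.
  set p := b - V *ᵥ (Vᵀ *ᵥ b) with hp
  have hVp : Vᵀ *ᵥ p = 0 := by
    rw [hp, Matrix.mulVec_sub, Matrix.mulVec_mulVec, hV.1, Matrix.one_mulVec, sub_self]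
  have hVM : Vᵀ * M = Matrix.diagonal ev * Vᵀ := by
    have := congrArg Matrix.transpose hV.mul_eq
    simpa [Matrix.transpose_mul, hMt] using this
  have hMp : M *ᵥ p = ν • p := by
    have : M *ᵥ (V *ᵥ (Vᵀ *ᵥ b)) = ν • (V *ᵥ (Vᵀ *ᵥ b)) := by
      rw [Matrix.mulVec_mulVec, hV.mul_eq, ← Matrix.mulVec_mulVec, Matrix.mulVec_mulVec _ _ Vᵀ,
        ← hVM, ← Matrix.mulVec_mulVec, hMb, Matrix.mulVec_smul, Matrix.mulVec_smul]
    rw [hp, Matrix.mulVec_sub, hMb, this, smul_sub]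
  have hby : b ⬝ᵥ y = p ⬝ᵥ y := by
    rw [hp, sub_dotProduct, mulVec_dotProduct_eq, hy, dotProduct_zero, sub_zero]
  by_cases hp0 : p = 0
  · rw [hby, hp0, zero_dotProduct]; simp
  · have := h ν p hp0 hMp hVp
    refine mul_le_mul_of_nonneg_right ?_ (sq_nonneg _)
    rw [← sq_abs (ν - c)]
    gcongr

/-- The part of `u` orthogonal to the eigenvectors `V` is controlled by the residual of `u`. -/
theorem sq_mul_dotProduct_proj_le {M : Matrix (Fin n) (Fin n) ℝ}
    (hM : M.IsHermitian) {ev : Fin r → ℝ} {V : Matrix (Fin n) (Fin r) ℝ}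
    (hV : IsOrthonormalEigenvectors M ev V) {c g : ℝ} (hg : 0 ≤ g)
    (h : ∀ (ν : ℝ) (w : Fin n → ℝ), w ≠ 0 → M *ᵥ w = ν • w → Vᵀ *ᵥ w = 0 → g ≤ |ν - c|)
    (u : Fin n → ℝ) :
    g ^ 2 * ((u - V *ᵥ (Vᵀ *ᵥ u)) ⬝ᵥ (u - V *ᵥ (Vᵀ *ᵥ u)))
      ≤ (M *ᵥ u - c • u) ⬝ᵥ (M *ᵥ u - c • u) := by
  set p := u - V *ᵥ (Vᵀ *ᵥ u) with hp
  have hVp : Vᵀ *ᵥ p = 0 := by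
    rw [hp, Matrix.mulVec_sub, Matrix.mulVec_mulVec, hV.1, Matrix.one_mulVec, sub_self]
  refine (sq_mul_dotProduct_le_of_eigenvector_bound hM hV hg h hVp).trans ?_
  have hVMp : Vᵀ *ᵥ (M *ᵥ p - c • p) = 0 := by
    have hMt : Mᵀ = M := by simpa [Matrix.IsHermitian] using hM
    have hVM : Vᵀ * M = Matrix.diagonal ev * Vᵀ := by
      have := congrArg Matrix.transpose hV.mul_eq
      simpa [Matrix.transpose_mul, hMt] using this
    rw [Matrix.mulVec_sub, Matrix.mulVec_smul, hVp, Matrix.mulVec_mulVec, hVM,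
      ← Matrix.mulVec_mulVec, hVp]
    simp
  -- The span of `V` and its complement are both invariant, so the residual of `p` is an orthogonal
  -- component of that of `u`.
  have hu : M *ᵥ u - c • u
      = V *ᵥ (fun j => (ev j - c) * (Vᵀ *ᵥ u) j) + (1 : ℝ) • (M *ᵥ p - c • p) := by
    have h1 : M *ᵥ (V *ᵥ (Vᵀ *ᵥ u)) = V *ᵥ (fun j => ev j * (Vᵀ *ᵥ u) j) := by
      rw [Matrix.mulVec_mulVec, hV.mul_eq, ← Matrix.mulVec_mulVec]
      congr 1
      ext j; rw [Matrix.mulVec_diagonal]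
    have h2 : (fun j => (ev j - c) * (Vᵀ *ᵥ u) j)
        = (fun j => ev j * (Vᵀ *ᵥ u) j) - c • (Vᵀ *ᵥ u) := by
      ext j; simp only [Pi.sub_apply, Pi.smul_apply, smul_eq_mul]; ring
    rw [h2, Matrix.mulVec_sub, Matrix.mulVec_smul, ← h1, hp, Matrix.mulVec_sub]
    module
  rw [hu, dotProduct_self_mulVec_add_smul hV.1 hVMp]
  have : 0 ≤ (fun j => (ev j - c) * (Vᵀ *ᵥ u) j) ⬝ᵥ (fun j => (ev j - c) * (Vᵀ *ᵥ u) j) :=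
    Finset.sum_nonneg fun i _ => mul_self_nonneg _
  linarith

theorem frobenius_norm_sq_eq (W : Matrix (Fin n) (Fin r) ℝ) : ‖W‖ ^ 2 = (Wᵀ * W).trace := by
  rw [Matrix.frobenius_norm_def, ← Real.sqrt_eq_rpow, Real.sq_sqrt (by positivity),
    Finset.sum_comm]
  simp only [Matrix.trace, Matrix.diag, Matrix.mul_apply, Matrix.transpose_apply, Real.norm_eq_abs]
  refine Finset.sum_congr rfl fun j _ => Finset.sum_congr rfl fun i _ => ?_
  norm_cast
  rw [sq_abs, sq]

/-- Compactness of the orthogonal group. -/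
theorem exists_isMinOn_procrustes (V U : Matrix (Fin n) (Fin r) ℝ) :
    ∃ Q ∈ Matrix.orthogonalGroup (Fin r) ℝ,
      ∀ Q' ∈ Matrix.orthogonalGroup (Fin r) ℝ, ‖V * Q - U‖ ≤ ‖V * Q' - U‖ := by
  have hcl : IsClosed (Matrix.orthogonalGroup (Fin r) ℝ : Set (Matrix (Fin r) (Fin r) ℝ)) := by
    have : (Matrix.orthogonalGroup (Fin r) ℝ : Set (Matrix (Fin r) (Fin r) ℝ))
        = {Q | Q * Qᵀ = 1} := by
      ext Q
      rw [SetLike.mem_coe, Matrix.mem_orthogonalGroup_iff]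
      rfl
    rw [this]
    exact isClosed_eq (by fun_prop) continuous_const
  have hcpt : IsCompact (Matrix.orthogonalGroup (Fin r) ℝ : Set (Matrix (Fin r) (Fin r) ℝ)) := by
    refine IsCompact.of_isClosed_subset
      (isCompact_univ_pi fun _ : Fin r => isCompact_univ_pi fun _ : Fin r =>
        isCompact_Icc (a := (-1 : ℝ)) (b := 1)) hcl fun Q hQ i _ j _ => ?_
    exact abs_le.1 (entry_norm_bound_of_unitary hQ i j)
  have hcont : Continuous fun Q : Matrix (Fin r) (Fin r) ℝ => ‖V * Q - U‖ := by
    have : ∀ Q : Matrix (Fin r) (Fin r) ℝ, ‖V * Q - U‖ = √(((V * Q - U)ᵀ * (V * Q - U)).trace) :=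
      fun Q => by rw [← frobenius_norm_sq_eq, Real.sqrt_sq (norm_nonneg _)]
    simp only [this]
    fun_prop
  obtain ⟨Q, hQ, hmin⟩ := hcpt.exists_isMinOn ⟨1, one_mem _⟩ hcont.continuousOn
  exact ⟨Q, hQ, fun Q' hQ' => hmin hQ'⟩

/-- For `N = Vᵀ U` one has `Nᵀ N = 1 - Eᵀ E`, with spectrum in `(0, 1]`. The polar factor `Q = N (Nᵀ
N)^(-1/2)` is orthogonal, and `tr (Qᵀ N) = tr (Nᵀ N)^(1/2) ≥ tr (Nᵀ N) = r - ‖E‖ ^ 2`, so `‖V Q - U‖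
^ 2 = 2 r - 2 tr (Qᵀ N) ≤ 2 ‖E‖ ^ 2`. -/
theorem minProcrustesLE_of_norm_sub_lt_one {V U : Matrix (Fin n) (Fin r) ℝ} (hV : Vᵀ * V = 1)
    (hU : Uᵀ * U = 1) (h : ‖U - V * (Vᵀ * U)‖ ^ 2 < 1) :
    MinProcrustesLE V U √(2 * ‖U - V * (Vᵀ * U)‖ ^ 2) := by
  set E := U - V * (Vᵀ * U) with hE
  set N := Vᵀ * U with hN
  have hNt : Nᵀ = Uᵀ * V := by rw [hN, Matrix.transpose_mul, Matrix.transpose_transpose]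
  have hS : Nᵀ * N = 1 - Eᵀ * E := by
    have : Eᵀ * E = Uᵀ * U - (Uᵀ * V) * (Vᵀ * U) - (Uᵀ * V) * (Vᵀ * U)
        + (Uᵀ * V) * (Vᵀ * V) * (Vᵀ * U) := by
      rw [hE, Matrix.transpose_sub, Matrix.transpose_mul, hNt, hN]
      simp only [Matrix.sub_mul, Matrix.mul_sub, Matrix.mul_assoc]
      abel
    rw [this, hV, hU, hNt, hN]
    simp
  set S := Nᵀ * N with hSdef
  have hSh : S.IsHermitian := Matrix.isHermitian_conjTranspose_mul_self N
  set b := fun i => (hSh.eigenvectorBasis i).ofLp with hb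
  set dd := hSh.eigenvalues with hdd
  have hSb : ∀ i, S *ᵥ b i = dd i • b i := hSh.mulVec_eigenvectorBasis
  have hbb : ∀ i, b i ⬝ᵥ b i = 1 := fun i => by
    rw [← inner_toLp_eq_dotProduct]
    have := hSh.eigenvectorBasis.orthonormal.1 i
    rw [real_inner_self_eq_norm_sq]
    simp only [hb, WithLp.toLp_ofLp, this]; norm_num
  have hdEq : ∀ i, dd i = 1 - (E *ᵥ b i) ⬝ᵥ (E *ᵥ b i) := by
    intro i
    have h1 : b i ⬝ᵥ (S *ᵥ b i) = dd i := by
      rw [hSb, dotProduct_smul, hbb, smul_eq_mul, mul_one]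
    rw [← h1, hS, Matrix.sub_mulVec, Matrix.one_mulVec, dotProduct_sub, hbb, mulVec_dotProduct_eq,
      Matrix.mulVec_mulVec]
  have hd1 : ∀ i, dd i ≤ 1 := fun i => by
    rw [hdEq]
    have : 0 ≤ (E *ᵥ b i) ⬝ᵥ (E *ᵥ b i) := Finset.sum_nonneg fun i _ => mul_self_nonneg _
    linarith
  have hd0 : ∀ i, 0 < dd i := fun i => by
    have h1 : (E *ᵥ b i) ⬝ᵥ (E *ᵥ b i) ≤ ‖E‖ ^ 2 := by
      rw [frobenius_norm_sq_eq, Matrix.trace]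
      simp only [Matrix.diag, Matrix.mul_apply, Matrix.transpose_apply]
      rw [Finset.sum_comm, dotProduct]
      refine Finset.sum_le_sum fun l _ => ?_
      have := Finset.sum_mul_sq_le_sq_mul_sq univ (fun j => E l j) (b i)
      have h2 : ∑ j, b i j ^ 2 = 1 := by
        rw [← hbb i, dotProduct]; exact Finset.sum_congr rfl fun j _ => sq _
      rw [h2, mul_one] at this
      simpa [Matrix.mulVec, dotProduct, sq] using this
    rw [hdEq]; linarith
  set W : Matrix (Fin r) (Fin r) ℝ := hSh.eigenvectorUnitary.1 with hW
  have hWW : Wᵀ * W = 1 := by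
    have := (Matrix.mem_unitaryGroup_iff'.1 hSh.eigenvectorUnitary.2)
    simpa [Matrix.star_eq_conjTranspose] using this
  have hWW' : W * Wᵀ = 1 := mul_eq_one_comm.1 hWW
  have hspec : S = W * Matrix.diagonal dd * Wᵀ := by
    have := hSh.spectral_theorem
    rw [Unitary.conjStarAlgAut_apply] at this
    simpa [Matrix.star_eq_conjTranspose] using this
  -- `R` is the inverse square root of `S`.
  set R := W * Matrix.diagonal (fun i => (√(dd i))⁻¹) * Wᵀ with hR
  have hRt : Rᵀ = R := by
    simp [hR, Matrix.transpose_mul, Matrix.mul_assoc]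
  have hRS : R * S = W * Matrix.diagonal (fun i => √(dd i)) * Wᵀ := by
    calc R * S = W * Matrix.diagonal (fun i => (√(dd i))⁻¹) * (Wᵀ * W) * Matrix.diagonal dd * Wᵀ := by
          rw [hR]; nth_rewrite 1 [hspec]; simp only [Matrix.mul_assoc]
      _ = _ := by
          rw [hWW, Matrix.mul_one, Matrix.mul_assoc W, Matrix.diagonal_mul_diagonal]
          congr 3
          ext i
          have := Real.sqrt_pos.2 (hd0 i)
          field_simp
          rw [Real.sq_sqrt (hd0 i).le]
  have hRSR : R * S * R = 1 := by
    rw [hRS]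
    calc W * Matrix.diagonal (fun i => √(dd i)) * Wᵀ * R
        = W * Matrix.diagonal (fun i => √(dd i)) * (Wᵀ * W) *
            Matrix.diagonal (fun i => (√(dd i))⁻¹) * Wᵀ := by
          rw [hR]; simp only [Matrix.mul_assoc]
      _ = 1 := by
          rw [hWW, Matrix.mul_one, Matrix.mul_assoc W, Matrix.diagonal_mul_diagonal]
          have : (fun i => √(dd i) * (√(dd i))⁻¹) = fun _ => 1 := by
            ext i; exact mul_inv_cancel₀ (Real.sqrt_pos.2 (hd0 i)).ne'
          rw [this, Matrix.diagonal_one, Matrix.mul_one, hWW']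
  set Q := N * R with hQ
  have hQQ : Qᵀ * Q = 1 := by
    rw [hQ, Matrix.transpose_mul, hRt, ← hRSR, hSdef]
    simp only [Matrix.mul_assoc]
  have hQmem : Q ∈ Matrix.orthogonalGroup (Fin r) ℝ := (Matrix.mem_orthogonalGroup_iff' _ _).2 hQQ
  have hQN : Qᵀ * N = W * Matrix.diagonal (fun i => √(dd i)) * Wᵀ := by
    rw [hQ, Matrix.transpose_mul, hRt, Matrix.mul_assoc, ← hSdef, hRS]
  have htr : r - ‖E‖ ^ 2 ≤ (Qᵀ * N).trace := by
    have h1 : (r : ℝ) - ‖E‖ ^ 2 = ∑ i, dd i := by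
      have : S.trace = ∑ i, dd i := by
        rw [hspec, Matrix.trace_mul_comm, ← Matrix.mul_assoc, hWW, Matrix.one_mul,
          Matrix.trace_diagonal]
      rw [← this, hS, Matrix.trace_sub, Matrix.trace_one, frobenius_norm_sq_eq, Fintype.card_fin]
    rw [h1, hQN, Matrix.trace_mul_comm, ← Matrix.mul_assoc, hWW, Matrix.one_mul,
      Matrix.trace_diagonal]
    -- `d ≤ √d` for eigenvalues `d` in `(0, 1]`.
    refine Finset.sum_le_sum fun i _ => Real.le_sqrt_of_sq_le ?_
    nlinarith [hd0 i, hd1 i]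
  have hnorm : ‖V * Q - U‖ ^ 2 ≤ 2 * ‖E‖ ^ 2 := by
    have h1 : ‖V * Q - U‖ ^ 2 = 2 * r - 2 * (Qᵀ * N).trace := by
      have h2 : (V * Q - U)ᵀ * (V * Q - U)
          = Qᵀ * (Vᵀ * V) * Q - Qᵀ * N - (Qᵀ * N)ᵀ + Uᵀ * U := by
        rw [hN]
        simp only [Matrix.transpose_sub, Matrix.transpose_mul, Matrix.transpose_transpose,
          Matrix.sub_mul, Matrix.mul_sub, Matrix.mul_assoc]
        abel
      rw [frobenius_norm_sq_eq, h2, hV, hU, Matrix.mul_one, hQQ, Matrix.trace_add,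
        Matrix.trace_sub, Matrix.trace_sub, Matrix.trace_transpose, Matrix.trace_one,
        Fintype.card_fin]
      ring
    rw [h1]; linarith
  obtain ⟨Q₀, hQ₀, hmin⟩ := exists_isMinOn_procrustes V U
  exact ⟨Q₀, hQ₀, hmin, (hmin Q hQmem).trans (Real.le_sqrt_of_sq_le hnorm)⟩

theorem MinProcrustesLE.mono {V U : Matrix (Fin n) (Fin r) ℝ} {a b : ℝ}
    (h : MinProcrustesLE V U a) (hab : a ≤ b) : MinProcrustesLE V U b := by
  obtain ⟨Q, hQ, hmin, hle⟩ := h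
  exact ⟨Q, hQ, hmin, hle.trans hab⟩
end

/-! ### From small discrepancy to the eigenvector bound -/

section
variable {d n k : ℕ} {Fi Fo : UnitAddTorus (Fin d) → ℝ}

/-- An eigenvector of `B_σ` is an approximate eigenvector of the adjacency matrix. -/
theorem residual_of_blockMatrix_eigenvector_le (hi : IsConnectivity Fi) (ho : IsConnectivity Fo)
    (σ : Fin n → Fin k) (hσ : IsBalanced σ) (hk : 0 < k) (hn : 0 < n)
    (X : Fin n → UnitAddTorus (Fin d)) (G : SimpleGraph (Fin n)) (Z : Finset (Fin d → ℤ))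
    (hZ : 0 ∈ Z) {c : ℝ} (hc : c ≠ 0) {u : Fin n → ℝ}
    (hu : blockMatrix (density Fi) (density Fo) σ *ᵥ u = c • u) :
    (adj G *ᵥ u - c • u) ⬝ᵥ (adj G *ᵥ u - c • u)
      ≤ k / n * discrepancy Fi Fo σ Z X G * (u ⬝ᵥ u) := by
  have hn' : (0 : ℝ) < n := by exact_mod_cast hn
  have hk' : (0 : ℝ) < k := by exact_mod_cast hk
  -- As `c ≠ 0`, the identity `u = c⁻¹ B_σ u` shows that `u` is constant on communities, with values
  -- `v`.
  set v : Fin k → ℝ := fun q =>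
    c⁻¹ * ∑ j, (if q = σ j then density Fi else density Fo) * u j with hv
  have huv : ∀ i, u i = v (σ i) := fun i => by
    have := congrFun hu i
    simp only [blockMatrix, Matrix.mulVec, dotProduct, Matrix.of_apply, Pi.smul_apply,
      smul_eq_mul] at this
    rw [hv]; simp only; rw [this]; field_simp
  -- `(A - B_σ) u` combines the residuals of community indicators, which are the modes of frequency
  -- `0`.
  set ρ : Fin k → Fin n → ℝ := fun q i =>
    ∑ j with σ j = q, (adj G i j - density (block Fi Fo (σ i) q)) with hρ
  have hρR : ∀ q i, ‖modeResidual Fi Fo σ 0 q i X G‖ ^ 2 = ρ q i ^ 2 := by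
    intro q i
    have : modeResidual Fi Fo σ 0 q i X G = (ρ q i : ℂ) := by
      rw [modeResidual_eq hi ho, hρ]
      push_cast
      refine Finset.sum_congr rfl fun j _ => ?_
      simp [UnitAddTorus.mFourier_zero, fourierCoeff_zero]
    rw [this, Complex.norm_real, Real.norm_eq_abs, sq_abs]
  have hres : ∀ i, (adj G *ᵥ u - c • u) i = ∑ q, v q * ρ q i := by
    intro i
    rw [← hu]
    simp only [blockMatrix, Pi.sub_apply, Matrix.mulVec, dotProduct, Matrix.of_apply,
      ← Finset.sum_sub_distrib]
    rw [← Finset.sum_fiberwise (s := univ) (g := σ)]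
    refine Finset.sum_congr rfl fun q _ => ?_
    rw [hρ, Finset.mul_sum]
    refine Finset.sum_congr rfl fun j hj => ?_
    rw [huv j, (Finset.mem_filter.1 hj).2]
    unfold block
    split_ifs <;> ring
  have hvu : (n / k : ℝ) * ∑ q, v q ^ 2 = u ⬝ᵥ u := by
    rw [dotProduct, ← Finset.sum_fiberwise (s := univ) (g := σ), Finset.mul_sum]
    refine Finset.sum_congr rfl fun q _ => ?_
    have h1 : ∀ j ∈ univ.filter (fun j => σ j = q), u j * u j = v q ^ 2 := fun j hj => by
      rw [huv j, (Finset.mem_filter.1 hj).2, sq]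
    rw [Finset.sum_congr rfl h1, Finset.sum_const, nsmul_eq_mul]
    have h2 : (k * #{j | σ j = q} : ℝ) = n := by exact_mod_cast hσ q
    have h3 : (n / k : ℝ) = #{j | σ j = q} := by rw [div_eq_iff hk'.ne']; linarith
    rw [h3]
  have hv2 : ∑ q, v q ^ 2 = k / n * (u ⬝ᵥ u) := by rw [← hvu]; field_simp
  calc (adj G *ᵥ u - c • u) ⬝ᵥ (adj G *ᵥ u - c • u)
      = ∑ i, (∑ q, v q * ρ q i) ^ 2 := by
        rw [dotProduct]; exact Finset.sum_congr rfl fun i _ => by rw [hres, sq]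
    _ ≤ ∑ i, (∑ q, v q ^ 2) * ∑ q, ρ q i ^ 2 :=
        Finset.sum_le_sum fun i _ => Finset.sum_mul_sq_le_sq_mul_sq _ _ _
    _ = (∑ q, v q ^ 2) * ∑ q, ∑ i, ‖modeResidual Fi Fo σ 0 q i X G‖ ^ 2 := by
        rw [← Finset.mul_sum, Finset.sum_comm]; simp only [hρR]
    _ ≤ (∑ q, v q ^ 2) * discrepancy Fi Fo σ Z X G := by
        gcongr
        exact discrepancy_mode_le σ Z X G hZ
    _ = _ := by rw [hv2]; ring

theorem isHermitian_adj (G : SimpleGraph (Fin n)) : (adj G).IsHermitian := by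
  ext i j
  simp [Matrix.conjTranspose_apply, adj_symm G i j]

/-- Each column of `U` has squared residual at most `(r + 1) * D / n`; dividing by the squared gap
`(ε * n) ^ 2` and summing over `r` columns bounds the part of `U` outside the span of `V`. -/
theorem minProcrustesLE_of_discrepancy_le {r : ℕ} (hi : IsConnectivity Fi)
    (ho : IsConnectivity Fo) (σ : Fin n → Fin (r + 1)) (hσ : IsBalanced σ) (hn : 0 < n)
    (X : Fin n → UnitAddTorus (Fin d)) (G : SimpleGraph (Fin n)) (Z : Finset (Fin d → ℤ))
    (hZ : 0 ∈ Z) {c ε D : ℝ} (hc : c ≠ 0) (hε : 0 < ε) (hD : discrepancy Fi Fo σ Z X G ≤ D)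
    (hgap : ∀ x : Fin n → ℝ, ∑ i, x i ^ 2 = 1 →
      (∀ p q, ∑ i with σ i = p, x i = ∑ i with σ i = q, x i) →
      (ε * n) ^ 2 ≤ ∑ i, ((adj G *ᵥ x) i - c * x i) ^ 2)
    (hsmall : r * ((r + 1) * D) / (ε ^ 2 * n ^ 3) < 1)
    {U V : Matrix (Fin n) (Fin r) ℝ}
    (hU : IsOrthonormalEigenvectors (blockMatrix (density Fi) (density Fo) σ) (fun _ => c) U)
    (hV : IsClosestEigenvectors (adj G) c V) :
    MinProcrustesLE V U √(2 * (r * ((r + 1) * D) / (ε ^ 2 * n ^ 3))) := by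
  have hn' : (0 : ℝ) < n := by exact_mod_cast hn
  let s : Fin (r + 1) → (Fin n → ℝ) →ₗ[ℝ] ℝ := fun p =>
    ∑ i with σ i = p, LinearMap.proj i
  have hs : ∀ p x, s p x = ∑ i with σ i = p, x i := fun p x => by
    simp [s, LinearMap.sum_apply]
  -- Its kernel consists of the vectors with equal community sums; comparing with community `0`
  -- takes only `r` conditions.
  let L : (Fin n → ℝ) →ₗ[ℝ] (Fin r → ℝ) := LinearMap.pi fun p => s p.succ - s 0
  have hL : ∀ x, L x = 0 →
      (ε * n) ^ 2 * (x ⬝ᵥ x) ≤ (adj G *ᵥ x - c • x) ⬝ᵥ (adj G *ᵥ x - c • x) := by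
    intro x hx
    have h0 : ∀ p, ∑ i with σ i = p, x i = ∑ i with σ i = 0, x i := by
      intro p
      refine Fin.cases rfl (fun p => ?_) p
      have := congrFun hx p
      simp only [L, LinearMap.pi_apply, LinearMap.sub_apply, hs, Pi.zero_apply] at this
      linarith
    by_cases hx0 : x = 0
    · simp [hx0]
    have hxx : 0 < x ⬝ᵥ x :=
      lt_of_le_of_ne (Finset.sum_nonneg fun i _ => mul_self_nonneg _)
        fun h => hx0 (dotProduct_self_eq_zero.1 h.symm)
    set a := (√(x ⬝ᵥ x))⁻¹ with ha
    have ha2 : a ^ 2 * (x ⬝ᵥ x) = 1 := by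
      rw [ha, inv_pow, Real.sq_sqrt hxx.le, inv_mul_cancel₀ hxx.ne']
    have ha0 : 0 < a ^ 2 := pow_pos (inv_pos.2 (Real.sqrt_pos.2 hxx)) 2
    have h1 := hgap (a • x) (by
      rw [← ha2, dotProduct, Finset.mul_sum]
      exact Finset.sum_congr rfl fun i _ => by simp only [Pi.smul_apply, smul_eq_mul]; ring)
      (fun p q => by
        simp only [Pi.smul_apply, smul_eq_mul, ← Finset.mul_sum]
        rw [h0 p, h0 q])
    have h2 : ∑ i, ((adj G *ᵥ (a • x)) i - c * (a • x) i) ^ 2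
        = a ^ 2 * ((adj G *ᵥ x - c • x) ⬝ᵥ (adj G *ᵥ x - c • x)) := by
      rw [dotProduct, Finset.mul_sum, Matrix.mulVec_smul]
      refine Finset.sum_congr rfl fun i _ => ?_
      simp only [Pi.smul_apply, Pi.sub_apply, smul_eq_mul]; ring
    rw [h2] at h1
    refine le_of_mul_le_mul_left ?_ ha0
    calc a ^ 2 * ((ε * n) ^ 2 * (x ⬝ᵥ x)) = (ε * n) ^ 2 * (a ^ 2 * (x ⬝ᵥ x)) := by ring
      _ = (ε * n) ^ 2 := by rw [ha2, mul_one]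
      _ ≤ _ := h1
  have hsep : ∀ (ν : ℝ) (w : Fin n → ℝ), w ≠ 0 → adj G *ᵥ w = ν • w → Vᵀ *ᵥ w = 0 →
      ε * n ≤ |ν - c| := fun ν w h1 h2 h3 => hV.le_abs_sub L hL h1 h2 h3
  obtain ⟨ev, hev, -⟩ := hV
  have hcol : ∀ j, ∑ i, (U - V * (Vᵀ * U)) i j ^ 2 ≤ (r + 1) * D / (ε ^ 2 * n ^ 3) := by
    intro j
    have h1 := sq_mul_dotProduct_proj_le (isHermitian_adj G) hev (by positivity) hsep (U.col j)
    have h2 := residual_of_blockMatrix_eigenvector_le hi ho σ hσ r.succ_pos hn X G Z hZ hc (hU.2 j)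
    have h3 : U.col j ⬝ᵥ U.col j = 1 := by
      have := congrFun (congrFun hU.1 j) j
      simpa [Matrix.mul_apply, dotProduct] using this
    have h4 : (U.col j - V *ᵥ (Vᵀ *ᵥ U.col j)) ⬝ᵥ (U.col j - V *ᵥ (Vᵀ *ᵥ U.col j))
        = ∑ i, (U - V * (Vᵀ * U)) i j ^ 2 := by
      rw [dotProduct]
      refine Finset.sum_congr rfl fun i _ => ?_
      have : (V *ᵥ (Vᵀ *ᵥ U.col j)) i = (V * (Vᵀ * U)) i j := by
        rw [Matrix.mulVec_mulVec, ← Matrix.mul_assoc]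
        simp [Matrix.mulVec, Matrix.mul_apply, dotProduct]
      rw [Pi.sub_apply, this, Matrix.sub_apply, Matrix.col_apply, sq]
    rw [h4] at h1
    rw [h3, mul_one] at h2
    rw [le_div_iff₀ (by positivity)]
    push_cast at h2
    have h5 : (r + 1 : ℝ) / n * discrepancy Fi Fo σ Z X G ≤ (r + 1) / n * D := by gcongr
    have h6 : (r + 1 : ℝ) / n * D * n = (r + 1) * D := by field_simp
    have h7 := mul_le_mul_of_nonneg_right (h1.trans (h2.trans h5)) hn'.le
    rw [h6] at h7
    linarith
  have hfro : ‖U - V * (Vᵀ * U)‖ ^ 2 ≤ r * ((r + 1) * D) / (ε ^ 2 * n ^ 3) := by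
    have : ‖U - V * (Vᵀ * U)‖ ^ 2 = ∑ j, ∑ i, (U - V * (Vᵀ * U)) i j ^ 2 := by
      rw [frobenius_norm_sq_eq, Matrix.trace]
      simp only [Matrix.diag, Matrix.mul_apply (M := (U - V * (Vᵀ * U))ᵀ), Matrix.transpose_apply, sq]
    rw [this]
    refine (Finset.sum_le_sum fun j _ => hcol j).trans (le_of_eq ?_)
    simp only [Finset.sum_const, Finset.card_univ, Fintype.card_fin, nsmul_eq_mul]
    ring
  refine (minProcrustesLE_of_norm_sub_lt_one hev.1 hU.1 (hfro.trans_lt hsmall)).mono ?_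
  gcongr
end
end SGBM

theorem mainTheorem2 (d k : ℕ) (hk : 2 ≤ k)
    (Fi Fo : UnitAddTorus (Fin d) → ℝ)
    (hFi_meas : Measurable Fi) (hFo_meas : Measurable Fo)
    (hFi_mem : ∀ x, Fi x ∈ Set.Icc (0 : ℝ) 1) (hFo_mem : ∀ x, Fo x ∈ Set.Icc (0 : ℝ) 1)
    (hFi_even : ∀ x, Fi (-x) = Fi x) (hFo_even : ∀ x, Fo (-x) = Fo x)
    (hμo : 0 < SGBM.density Fo) (hμ : SGBM.density Fo < SGBM.density Fi)
    (hsum : ∀ z : Fin d → ℤ,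
      SGBM.fourierCoeff Fi z + ((k : ℂ) - 1) * SGBM.fourierCoeff Fo z ≠
        ((SGBM.density Fi - SGBM.density Fo : ℝ) : ℂ))
    (hdiff : ∀ z : Fin d → ℤ, z ≠ 0 →
      SGBM.fourierCoeff Fi z - SGBM.fourierCoeff Fo z ≠
        ((SGBM.density Fi - SGBM.density Fo : ℝ) : ℂ)) :
    ∃ ε : ℝ, 0 < ε ∧
      ∀ (n : ℕ → ℕ) (_ : Tendsto n atTop atTop)
        (σ : (m : ℕ) → Fin (n m) → Fin k) (_ : ∀ m, SGBM.IsBalanced (σ m)),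
        Tendsto
          (fun m => SGBM.prob Fi Fo (σ m)
            {G | ∀ U V : Matrix (Fin (n m)) (Fin (k - 1)) ℝ,
              SGBM.IsOrthonormalEigenvectors
                (SGBM.blockMatrix (SGBM.density Fi) (SGBM.density Fo) (σ m))
                (fun _ => (SGBM.density Fi - SGBM.density Fo) / k * n m) U →
              SGBM.IsClosestEigenvectors (SGBM.adj G)
                ((SGBM.density Fi - SGBM.density Fo) / k * n m) V →
              SGBM.MinProcrustesLE V U
                (√(12 * (k : ℝ) ^ 5 * Real.log (n m)) / (ε * √(n m : ℝ)))})
          atTop (𝓝 1) := by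
  have hi : SGBM.IsConnectivity Fi := ⟨hFi_meas, hFi_mem, hFi_even⟩
  have ho : SGBM.IsConnectivity Fo := ⟨hFo_meas, hFo_mem, hFo_even⟩
  obtain ⟨ε, hε, Z, hZ, hgap⟩ := SGBM.exists_spectral_gap hk hi ho hμ hsum hdiff
  obtain ⟨r, rfl⟩ : ∃ r, k = r + 1 := ⟨k - 1, by omega⟩
  refine ⟨ε, hε, fun n hn σ hσ => ?_⟩
  have hnR : Tendsto (fun m => (n m : ℝ)) atTop atTop := tendsto_natCast_atTop_atTop.comp hn
  have hlog : Tendsto (fun m => Real.log (n m)) atTop atTop := Real.tendsto_log_atTop.comp hnR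
  have hratio : Tendsto (fun m => Real.log (n m) / n m) atTop (𝓝 0) :=
    (Real.isLittleO_log_id_atTop.tendsto_div_nhds_zero).comp hnR
  set C : ℝ := 12 * (Z.card * (r + 1 : ℕ)) + 20 with hC
  have hlow : Tendsto (fun m => 1 - C / Real.log (n m)) atTop (𝓝 1) := by
    simpa using (tendsto_const_nhds (x := C)).div_atTop hlog |>.const_sub 1
  refine tendsto_of_tendsto_of_tendsto_of_le_of_le' hlow tendsto_const_nhds ?_
    (Eventually.of_forall fun m => SGBM.prob_le_one hi ho _ _)
  -- The first bound on `log n / n` puts `n ^ 2 * log n` below the discrepancy `ε ^ 4 * n ^ 3`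
  -- allowed by the gap; the second makes the projection error less than one.
  have hδ : (0 : ℝ) < min (ε ^ 4) (ε ^ 2 / ((r + 1) * (r + 1))) := by positivity
  filter_upwards [hlog.eventually_gt_atTop 0, hnR.eventually_gt_atTop 0,
    hnR.eventually_ge_atTop (1 / ε ^ 4), hratio.eventually (gt_mem_nhds hδ)] with m h1 h2 h3 h4
  set N : ℝ := (n m : ℝ) with hN
  have hn0 : 0 < n m := Nat.cast_pos.1 h2
  have h5 : Real.log N < ε ^ 4 * N := (div_lt_iff₀ h2).1 (h4.trans_le (min_le_left _ _))
  have h6 : Real.log N * ((r + 1) * (r + 1)) < ε ^ 2 * N := by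
    have := (div_lt_iff₀ h2).1 (h4.trans_le (min_le_right _ _))
    rwa [div_mul_eq_mul_div, lt_div_iff₀ (by positivity)] at this
  have h7 : C / Real.log N = C * N ^ 2 / (N ^ 2 * Real.log N) := by field_simp
  rw [h7]
  -- The threshold is `t = N ^ 2 * log N`, so the failure probability is at most `C / log N`.
  refine SGBM.one_sub_le_prob hi ho (σ m) Z _ (by positivity) fun X G hX U V hU hV => ?_
  have hc : (SGBM.density Fi - SGBM.density Fo) / ((r + 1 : ℕ) : ℝ) * N ≠ 0 := by
    have := sub_pos.2 hμ
    positivity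
  have hg := hgap (n m) (by rw [div_le_iff₀ (by positivity)] at h3; linarith) (σ m) (hσ m) X G
    (hX.le.trans (by
      calc N ^ 2 * Real.log N ≤ N ^ 2 * (ε ^ 4 * N) := by gcongr
        _ = ε ^ 4 * N ^ 3 := by ring))
  have heq : (r : ℝ) * ((r + 1) * (N ^ 2 * Real.log N)) / (ε ^ 2 * N ^ 3)
      = r * (r + 1) * Real.log N / (ε ^ 2 * N) := by field_simp
  have hb := SGBM.minProcrustesLE_of_discrepancy_le hi ho (σ m) (hσ m) hn0 X G Z hZ hc hε hX.le hg
    (by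
      rw [heq, div_lt_one (by positivity)]
      nlinarith) hU hV
  refine hb.mono ?_
  rw [heq]
  have hrhs : √(12 * ((r + 1 : ℕ) : ℝ) ^ 5 * Real.log N) / (ε * √N)
      = √(12 * ((r + 1 : ℕ) : ℝ) ^ 5 * Real.log N / (ε ^ 2 * N)) := by
    rw [Real.sqrt_div (by positivity), Real.sqrt_mul (by positivity) N, Real.sqrt_sq hε.le]
  rw [hrhs, ← mul_div_assoc]
  apply Real.sqrt_le_sqrt
  refine div_le_div_of_nonneg_right ?_ (by positivity)
  rw [← mul_assoc]
  refine mul_le_mul_of_nonneg_right ?_ h1.le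
  push_cast
  have hr : (0 : ℝ) ≤ r := by positivity
  -- The argument yields the constant `2 r (r + 1)`, which is below `12 (r + 1) ^ 5`.
  have h8 : ((r : ℝ) + 1) ^ 2 ≤ (r + 1) ^ 5 := pow_le_pow_right₀ (by linarith) (by norm_num)
  nlinarith
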